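/- **Setting.** Fix sets $\mathbf H(m)$ ($m<\omega$) with at least two elements each, and an element of each $\mathbf H(m)$, written $0$. Sequences are elements of $\bigcup_n\prod_{i<n}\mathbf H(i)$; $u\trianglelefteq v$ means that $u$ is an initial segment of $v$ and $u\vartriangleleft v$ that it is a proper one; $\mathbf 0_{[a,b)}$ is the zero sequence on $[a,b)$. A *creature* is a triple $t=(\mathrm{nor}[t],\mathrm{val}[t],\mathrm{dis}[t])$ where $\mathrm{nor}[t]\in\mathbb R^{\ge 0}$, $\mathrm{dis}[t]$ is an arbitrary label, and $\mathrm{val}[t]\ne\emptyset$ is a set of pairs $\langle x,y\rangle$ of sequences such that $x\vartriangleleft y$, all the $x$ have one length $m^t_{\rm dn}$ and all the $y$ have one length $m^t_{\rm up}$. A *creating pair* $(K,\Sigma)$ consists of a set $K$ of creatures and an operation assigning to each finite sequence from $K$ a set $\Sigma(t_0,\dots,t_{n-1})\subseteq K$ such that: $\Sigma$ of the empty sequence is $\emptyset$; $t\in\Sigma(t)$; if $s_i\in\Sigma(\bar t_i)$ for $i<m$ then $\Sigma(s_0,\dots,s_{m-1})\subseteq\Sigma(\bar t_0{}^\frown\cdots{}^\frown\bar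 t_{m-1})$; if $\Sigma(t_0,\dots,t_{n-1})\neq\emptyset$ then $m^{t_i}_{\rm up}=m^{t_{i+1}}_{\rm dn}$ for $i<n-1$; and $m^s_{\rm dn}=m^{t_0}_{\rm dn}$, $m^s_{\rm up}=m^{t_{n-1}}_{\rm up}$ for $s\in\Sigma(t_0,\dots,t_{n-1})$. Let $\mathrm{basis}(t)=\{w:(\exists s\in\Sigma(t))(\exists u)\,\langle w,u\rangle\in\mathrm{val}[s]\}$, and let $\mathrm{pos}(w,t_0,\dots,t_{n-1})$ be the set of all $v$ for which there are $0=k_0<k_1<\dots<k_\ell=n$ and $w=v_0\vartriangleleft v_1\vartriangleleft\dots\vartriangleleft v_\ell=v$ with $\langle v_i,v_{i+1}\rangle\in\mathrm{val}[s]$ for some $s\in\Sigma(t_{k_i},\dots,t_{k_{i+1}-1})$, for all $i<\ell$; for the empty sequence it is $\{w\}$. $(w,t_0,\dots,t_{n-1})\in\mathrm{FC}$ ($n\ge 1$) means that $t_i\in K$, $m^{t_i}_{\rm up}=m^{t_{i+1}}_{\rm dn}$ and $\mathrm{pos}(w,t_0,\dots,t_{i-1})\subseteq\mathrm{basis}(t_i)$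 for all relevant $i$ (for $i=0$: $w\in\mathrm{basis}(t_0)$), and $(t_0,\dots,t_{n-1})\in\mathrm{PFC}$ means that this holds for some $w$. $\mathrm{PC}$ is defined like $\mathrm{PFC}$, for infinite sequences. For infinite sequences, $\bar t\le\bar s$ means that for some $0=k_0<k_1<\cdots$ we have $s_i\in\Sigma(t_{k_i},\dots,t_{k_{i+1}-1})$ for all $i$. For $t,t'\in K$, $t\sim_\Sigma t'$ means that $t,t'$ have the same $\mathrm{nor}$ and $\mathrm{val}$ and that replacing $t$ by $t'$ at a place of any sequence does not change the value of $\Sigma$ at it. All creating pairs below are assumed to be * *nice*: $\mathrm{basis}(t_0)\subseteq\mathrm{basis}(s)$ for $s\in\Sigma(t_0,\dots,t_{n-1})$; and * *smooth*: if $(w,t_0,\dots,t_{n-1})\in\mathrm{FC}$, $m<n$, $u\in\mathrm{pos}(w,t_0,\dots,t_{n-1})$ then $u{\restriction}m^{t_m}_{\rm dn}\in\mathrm{pos}(w,t_0,\dots,t_{m-1})$ and $u\in\mathrm{pos}(u{\restriction}m^{t_m}_{\rm dn},t_m,\dots,t_{n-1})$. *The forcing notions.* Conditions of $\mathbb Q^*_\emptyset(K,\Sigma)$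 are all $p=(w,t_0,t_1,\dots)$ (also written $(w^p,t^p_0,t^p_1,\dots)$) with $t_i\in K$, $m^{t_i}_{\rm up}=m^{t_{i+1}}_{\rm dn}$ and $\mathrm{pos}(w,t_0,\dots,t_{i-1})\subseteq\mathrm{basis}(t_i)$ for all $i<\omega$. $\mathbb Q^*_{{\rm s}\infty}(K,\Sigma)$ is the set of those conditions for which $\mathrm{nor}[t_i]>\max\{i,m^{t_i}_{\rm dn}\}$ for all $i$, ordered by: $p\le q$ ($q$ is stronger) iff for some $k_0<k_1<\cdots$ we have $w^q\in\mathrm{pos}(w^p,t^p_0,\dots,t^p_{k_0-1})$ and $t^q_i\in\Sigma(t^p_{k_i},\dots,t^p_{k_{i+1}-1})$ for all $i$. A forcing notion $\mathbb P$ is *almost $\omega^\omega$-bounding* if for every $\mathbb P$-name $\dot f$ for an element of $\omega^\omega$ and every $p\in\mathbb P$ there is $g\in\omega^\omega$ such that for every infinite $A\subseteq\omega$ there is $q\ge p$ with $q\Vdash(\exists^\infty n\in A)(\dot f(n)<g(n))$. *Properties of $(K,\Sigma)$.* * *Finitary*: all $\mathbf H(m)$ and all $\mathrm{val}[t]$,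 $t\in K$, are finite. *Strongly finitary*: moreover every $\Sigma(t_0,\dots,t_{n-1})$ is finite modulo $\sim_\Sigma$. * *Growing*: for each $(t_0,\dots,t_{n-1})\in\mathrm{PFC}$ there is $t\in\Sigma(t_0,\dots,t_{n-1})$ with $\mathrm{nor}[t]\ge\max_{i<n}\mathrm{nor}[t_i]$. * *Condensed*: if $(w,t_0,\dots,t_{n-1})\in\mathrm{FC}$, all $\mathrm{nor}[t_i]>0$, $t\in\Sigma(t_0,\dots,t_{n-1})$ and $\mathrm{nor}[t]>0$, then there are $k<n$, $s\in\Sigma(t_k)$ with $\mathrm{nor}[s]>0$ and $v\in\mathrm{pos}(w,t_0,\dots,t_{k-1})$ such that $(\forall u\in\mathrm{pos}(v,s))(\exists u^*\in\mathrm{pos}(w,t))(u\trianglelefteq u^*)$. * *AB-type*: the following two conditions hold. 1. If $(t_0,\dots,t_{n-1})\in\mathrm{PFC}$ and $k<n$, then there is $t\in\Sigma(t_0,\dots,t_{n-1})$ with $\mathrm{nor}[t]\ge\min_{\ell<n}\mathrm{nor}[t_\ell]$ such that whenever $(w,t_0,\dots,t_{n-1})\in\mathrm{FC}$, $t'\in\Sigma(t)$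 and $\mathrm{nor}[t']>0$, there is $t''\in\Sigma(t_k)$ with $\mathrm{nor}[t'']>0$ and $(\exists u'\in\mathrm{pos}(w,t_0,\dots,t_{k-1}))(\forall u''\in\mathrm{pos}(u',t''))(\exists v\in\mathrm{pos}(w,t'))(u''\trianglelefteq v)$. 2. Let $p\in\mathbb Q^*_\emptyset(K,\Sigma)$, $N_0<\omega$, $\mathrm{nor}[t^p_i]>2$ for $i\ge N_0$, and let $z$ be a *decision function*, i.e. $z:\mathrm{pos}(w^p,t^p_0,\dots,t^p_{N_0-1})\times\mathrm{PC}\to\bigcup_{k\ge N_0}\mathrm{pos}(w^p,t^p_0,\dots,t^p_{k-1})$ and for all $v$ in its first domain and all $\bar t'\in\mathrm{PC}$ with $\langle t^p_{N_0},t^p_{N_0+1},\dots\rangle\le\bar t'$ there is $k$ with $z(v,\bar t')\in\mathrm{pos}(v,t'_0,\dots,t'_{k-1})$ such that $z(v,\bar t'')=z(v,\bar t')$ whenever $\langle t^p_{N_0},\dots\rangle\le\bar t''\in\mathrm{PC}$ and $t''_i\sim_\Sigma t'_i$ for $i<k$. Then there are $N_1>N_0$ and $t^*\in\Sigma(t^p_{N_0},\dots,t^p_{N_1-1})$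 with $\mathrm{nor}[t^*]\ge\frac12\min\{\mathrm{nor}[t^p_i]:N_0\le i<N_1\}$ such that for each $v\in\mathrm{pos}(w^p,t^p_0,\dots,t^p_{N_0-1})$ and $t\in\Sigma(t^*)$ with $\mathrm{nor}[t]>0$ there is $\bar t'\in\mathrm{PC}$ with $\langle t^p_{N_0},\dots\rangle\le\bar t'$ such that ($\alpha$) if $t'_i\in\Sigma(t^p_{N_0+k},\dots,t^p_{N_0+k+\ell})$ then $\mathrm{nor}[t'_i]\ge\frac12\min\{\mathrm{nor}[t^p_{N_0+k}],\dots,\mathrm{nor}[t^p_{N_0+k+\ell}]\}$, and ($\beta$) $(\exists w\in\mathrm{pos}(v,t))(z(v,\bar t')\trianglelefteq w)$. * For $m_0\le m^t_{\rm dn}$, $m^t_{\rm up}\le m_1$ let $s=t\Rsh[m_0,m_1)$ be given by $\mathrm{nor}[s]=\mathrm{nor}[t]$, $\mathrm{val}[s]=\{\langle w,u\rangle: \mathrm{lh}(w)=m_0,\ \mathrm{lh}(u)=m_1,\ w\vartriangleleft u,\ \langle u{\restriction}m^t_{\rm dn},u{\restriction}m^t_{\rm up}\rangle\in\mathrm{val}[t],\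 u(i)=0\text{ for }i\in[m_0,m^t_{\rm dn})\cup[m^t_{\rm up},m_1)\}$, and $\mathrm{dis}[s]=e(m_0,m_1,\mathrm{dis}[t])$, where $e$ is any fixed rule (e.g. $e(m_0,m_1,x)=\langle 4,m_0,m_1,x\rangle$). $(K,\Sigma)$ is *omittory* if (0) for $t\in K$, $u\in\mathrm{basis}(t)$ we have $u{}^\frown\mathbf 0_{[m^t_{\rm dn},m^t_{\rm up})}\in\mathrm{pos}(u,t)$ and some $v\in\mathrm{pos}(u,t)$ is not zero on $[m^t_{\rm dn},m^t_{\rm up})$; (1) $t_i\Rsh[m^{t_0}_{\rm dn},m^{t_{n-1}}_{\rm up})\in\Sigma(t_0,\dots,t_{n-1})$ for all $(t_0,\dots,t_{n-1})\in\mathrm{PFC}$, $i<n$; (2) if $t,\,t\Rsh[m_0,m_1)\in K$, $u\in\mathrm{basis}(t\Rsh[m_0,m_1))$, $v\in\mathrm{pos}(u,t\Rsh[m_0,m_1))$, $\mathrm{lh}(u)\le n<\mathrm{lh}(v)$ and $v(n)\ne 0$, then $n\in[m^t_{\rm dn},m^t_{\rm up})$. * *Weak Halving Property*: there is a map $\mathrm{half}:K\to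 K$ (which is then fixed) such that $\mathrm{half}(t)\in\Sigma(t)$, $\mathrm{nor}[\mathrm{half}(t)]\ge\frac12\mathrm{nor}[t]$ for $t\in K$, and if $\mathrm{nor}[t_0]\ge2$, $t\in\Sigma(\mathrm{half}(t_0))$, $\mathrm{nor}[t]>0$, then there is $s\in\Sigma(t_0)$ with $\mathrm{nor}[s]\ge\frac12\mathrm{nor}[t_0]$ and $\mathrm{pos}(u,s)\subseteq\mathrm{pos}(u,t)$ for all $u\in\mathrm{basis}(t_0)$. * A *nice pre-norm with values in $\omega$* is a monotone $N:\mathcal P(\omega)\to\omega$ with $N(\omega)>0$, $N(\{a\})\le1$ for $a\in\omega$, such that if $B\subseteq C$ and $N(C)>1$ then $N(B)\ge N(C)-1$ or $N(C\setminus B)\ge N(C)-1$. For creatures $t_i$ ($m_0\le i<m_1$) with $m^{t_i}_{\rm up}\le m^{t_{i+1}}_{\rm dn}$ and a nonempty $u\subseteq[m_0,m_1)$ let $S_{N,u}(t_i:m_0\le i<m_1)$ have norm $\min(\{N(u)\}\cup\{\mathrm{nor}[t_i]:i\in u\})$, value the set of all $\langle h_1,h_2\rangle$ with $\mathrm{lh}(h_1)=m^{t_{m_0}}_{\rm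 dn}$, $\mathrm{lh}(h_2)=m^{t_{m_1-1}}_{\rm up}$, $h_1\vartriangleleft h_2$, $\langle h_2{\restriction}m^{t_i}_{\rm dn},h_2{\restriction}m^{t_i}_{\rm up}\rangle\in\mathrm{val}[t_i]$ for $i\in u$ and $h_2$ zero on $[m^{t_i}_{\rm dn},m^{t_i}_{\rm up})$ for $i\notin u$ and on all $[m^{t_i}_{\rm up},m^{t_{i+1}}_{\rm dn})$, and a label given by any fixed rule from $N$, $u$, $m_0$ and $\langle\mathrm{dis}[t_i]:m_0\le i<m_1\rangle$. $(K,\Sigma)$ is *saturated* with respect to such pre-norms if for each such $N$, each $(t_i:m_0\le i<m_1)\in\mathrm{PFC}$ and each nonempty $u\subseteq[m_0,m_1)$ with $N(u)>0$ and $\mathrm{nor}[t_i]>0$ for $i\in u$: $S=S_{N,u}(t_i:m_0\le i<m_1)\in\Sigma(t_i:m_0\le i<m_1)$, and for each $t\in\Sigma(S)$ with $\mathrm{nor}[t]>0$ there are a nonempty $u^*\subseteq u$ with $N(u^*)>0$ and $s_i\in\Sigma(t_i)$ ($m_0\le i<m_1$) such that $\mathrm{nor}[s_i]>0$ for $i\in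 u^*$ and $\mathrm{val}[S_{N,u^*}(s_i:m_0\le i<m_1)]\subseteq\mathrm{val}[t]$. **Theorem.** Let $(K,\Sigma)$ be a (nice and smooth) creating pair. 1. If $(K,\Sigma)$ is finitary, growing, condensed and of the AB-type, then $\mathbb Q^*_{{\rm s}\infty}(K,\Sigma)$ is almost $\omega^\omega$-bounding. 2. Suppose that $(K,\Sigma)$ is strongly finitary and omittory, has the weak Halving Property, is saturated with respect to nice pre-norms with values in $\omega$, and that for each $t\in K$: * $(\otimes_1)$ $\mathrm{val}[s]\subseteq\mathrm{val}[t]$ for all $s\in\Sigma(t)$; * $(\otimes_2)$ if $m_0\le m^t_{\rm dn}$, $m^t_{\rm up}\le m_1$, $t\Rsh[m_0,m_1)\in K$ and $s\in\Sigma(\mathrm{half}(t))$, then $s\Rsh[m_0,m_1)\in\Sigma(\mathrm{half}(t\Rsh[m_0,m_1)))$; * $(\oplus_3)$ if $m_0\le m^t_{\rm dn}$, $m^t_{\rm up}\le m_1$ and $t\Rsh[m_0,m_1)\in K$, then $\Sigma(t\Rsh[m_0,m_1))=\{s\Rsh[m_0,m_1):s\in\Sigma(t)\}$ modulo $\sim_\Sigma$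 (each element of either set is $\sim_\Sigma$-equivalent to an element of the other). Then $(K,\Sigma)$ is of the AB-type. Consequently, if $(K,\Sigma)$ is moreover condensed, then $\mathbb Q^*_{{\rm s}\infty}(K,\Sigma)$ is almost $\omega^\omega$-bounding. -/

import Mathlib

open scoped NNReal

namespace Creatures

universe u v

/-! ## Finite sequences -/

/-- The function `𝐇`: a sequence of sets `𝐇(m)`, `m < ω`, each with at least two elements, and with a
fixed element of each, which is written `0`. -/
structure Alphabet (A : Type u) where
  carrier : ℕ → Set A
  zero : ℕ → A
  zero_mem : ∀ m, zero m ∈ carrier m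
  two_le : ∀ m, (carrier m).Nontrivial

variable {A : Type u} {D : Type v}

/-- `w ∈ ∏_{i < lh(w)} 𝐇(i)`. -/
def Alphabet.IsSeq (H : Alphabet A) (w : List A) : Prop :=
  ∀ i a, w[i]? = some a → a ∈ H.carrier i

/-- The sequence `0_{[a,b)}`. -/
def Alphabet.zeros (H : Alphabet A) (a b : ℕ) : List A :=
  (List.range' a (b - a)).map H.zero

/-- `w` is identically zero on `[a,b)`. -/
def Alphabet.ZeroOn (H : Alphabet A) (w : List A) (a b : ℕ) : Prop :=
  ∀ i, a ≤ i → i < b → w[i]? = some (H.zero i)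

/-- The list `[t a, t (a+1), …, t (b-1)]`. -/
def seg {X : Type*} (t : ℕ → X) (a b : ℕ) : List X :=
  (List.range' a (b - a)).map t

/-! ## Weak creatures and creatures -/

/-- The data `(nor, val, dis)` of a weak creature.  `D` is the type of the distinguishing labels. -/
structure WeakCreature (A : Type u) (D : Type v) where
  nor : ℝ≥0
  val : Set (List A × List A)
  dis : D

/-- `t` is a weak creature for `𝐇`. -/
def IsWeakCreature (H : Alphabet A) (t : WeakCreature A D) : Prop :=
  t.val.Nonempty ∧
    ∀ x y, (x, y) ∈ t.val → H.IsSeq x ∧ H.IsSeq y ∧ x <+: y ∧ x ≠ y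

namespace WeakCreature

/-- `m_dn`: the least length of an element of the domain of `val`. -/
noncomputable def mdn (t : WeakCreature A D) : ℕ :=
  sInf {n | ∃ x ∈ t.val, x.1.length = n}

/-- `m_up`: the least length of an element of the range of `val`. -/
noncomputable def mup (t : WeakCreature A D) : ℕ :=
  sInf {n | ∃ x ∈ t.val, x.2.length = n}

/-- The creature `t ⇛ [m₀, m₁)`, where `e` is the rule that produces its label from
`m₀`, `m₁` and the label of `t`. -/
noncomputable def extend (H : Alphabet A) (e : ℕ → ℕ → D → D) (t : WeakCreature A D)
    (m₀ m₁ : ℕ) : WeakCreature A D where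
  nor := t.nor
  val := {x | H.IsSeq x.1 ∧ H.IsSeq x.2 ∧ x.1.length = m₀ ∧ x.2.length = m₁ ∧
    x.1 <+: x.2 ∧ x.1 ≠ x.2 ∧ (x.2.take t.mdn, x.2.take t.mup) ∈ t.val ∧
    H.ZeroOn x.2 m₀ t.mdn ∧ H.ZeroOn x.2 t.mup m₁}
  dis := e m₀ m₁ t.dis

end WeakCreature

/-- `t` is a creature for `𝐇`: the lengths of both components of the elements of `val[t]` are
constant. -/
def IsCreature (H : Alphabet A) (t : WeakCreature A D) : Prop :=
  IsWeakCreature H t ∧ ∀ x ∈ t.val, x.1.length = t.mdn ∧ x.2.length = t.mup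

/-- `min {nor[t_i] : a ≤ i < b}` (for `a < b`). -/
noncomputable def minNor (t : ℕ → WeakCreature A D) (a b : ℕ) : ℝ≥0 :=
  sInf ((fun i => (t i).nor) '' Set.Ico a b)

/-! ## Creating pairs -/

/-- A creating pair `(K, Σ)` for `𝐇`.  A set of creatures on which a composition operation can be
nonempty can be listed as `t_0, …, t_{m-1}` with `m_up(t_i) = m_dn(t_{i+1})` in exactly one way,
and it is identified with this list; `Σ` is empty at all other lists. -/
structure CreatingPair (H : Alphabet A) (D : Type v) where
  K : Set (WeakCreature A D)
  Sig : List (WeakCreature A D) → Set (WeakCreature A D)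
  isCreature : ∀ t ∈ K, IsCreature H t
  sig_subset : ∀ l, Sig l ⊆ K
  mem_of_sig : ∀ l, (Sig l).Nonempty → ∀ t ∈ l, t ∈ K
  sig_nil : Sig [] = ∅
  sig_self : ∀ t ∈ K, t ∈ Sig [t]
  sig_trans : ∀ (l : List (WeakCreature A D)) (L : List (List (WeakCreature A D))),
    List.Forall₂ (fun s S => s ∈ Sig S) l L → Sig l ⊆ Sig L.flatten
  sig_chain : ∀ l, (Sig l).Nonempty → l.IsChain (fun s t => s.mup = t.mdn)
  sig_mdn : ∀ (l : List (WeakCreature A D)) (hl : l ≠ []), ∀ s ∈ Sig l, s.mdn = (l.head hl).mdn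
  sig_mup : ∀ (l : List (WeakCreature A D)) (hl : l ≠ []), ∀ s ∈ Sig l, s.mup = (l.getLast hl).mup

namespace CreatingPair

variable {H : Alphabet A} (P : CreatingPair H D)

/-- `t₀ ∼_Σ t₁`. -/
def Equivalent (t₀ t₁ : WeakCreature A D) : Prop :=
  t₀ ∈ P.K ∧ t₁ ∈ P.K ∧ t₀.nor = t₁.nor ∧ t₀.val = t₁.val ∧
    ∀ l l' : List (WeakCreature A D), P.Sig (l ++ t₀ :: l') = P.Sig (l ++ t₁ :: l')

/-- `basis(t)`. -/
def basis (t : WeakCreature A D) : Set (List A) :=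
  {w | ∃ s ∈ P.Sig [t], ∃ u, (w, u) ∈ s.val}

/-- `v ∈ pos(w, t_0, …, t_{n-1})`: one can go from `w` to `v` in finitely many steps, the sequence
`t_0, …, t_{n-1}` being cut into consecutive pieces, and each step using an element of `Σ` of the
respective piece.  In particular `pos(w) = {w}` for the empty sequence. -/
inductive Pos (w : List A) : List (WeakCreature A D) → List A → Prop
  | nil : Pos w [] w
  | step {l l' : List (WeakCreature A D)} {u v : List A} {s : WeakCreature A D} :
      Pos w l u → s ∈ P.Sig l' → (u, v) ∈ s.val → Pos w (l ++ l') v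

/-- `pos(w, t_0, …, t_{n-1})`. -/
def pos (w : List A) (l : List (WeakCreature A D)) : Set (List A) := {v | P.Pos w l v}

/-- `(w, t_a, …, t_{b-1}) ∈ FC(K, Σ)`. -/
def FC (w : List A) (t : ℕ → WeakCreature A D) (a b : ℕ) : Prop :=
  a < b ∧ (∀ i, a ≤ i → i < b → t i ∈ P.K ∧ P.pos w (seg t a i) ⊆ P.basis (t i)) ∧
    ∀ i, a ≤ i → i + 1 < b → (t i).mup = (t (i + 1)).mdn

/-- `(t_a, …, t_{b-1}) ∈ PFC(K, Σ)`. -/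
def PFC (t : ℕ → WeakCreature A D) (a b : ℕ) : Prop := ∃ w, P.FC w t a b

/-- `t_i ∈ K`, `m_up(t_i) = m_dn(t_{i+1})`, `w ∈ basis(t_0)` and
`pos(w, t_0, …, t_i) ⊆ basis(t_{i+1})` for all `i < ω`. -/
def Candidate (w : List A) (t : ℕ → WeakCreature A D) : Prop :=
  ∀ i, t i ∈ P.K ∧ (t i).mup = (t (i + 1)).mdn ∧ P.pos w (seg t 0 i) ⊆ P.basis (t i)

/-- `⟨t_0, t_1, …⟩ ∈ PC(K, Σ)`. -/
def PC (t : ℕ → WeakCreature A D) : Prop := ∃ w, P.Candidate w t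

/-- The order `⟨t_0, t_1, …⟩ ≤ ⟨s_0, s_1, …⟩` of pure candidates. -/
def PCLe (t s : ℕ → WeakCreature A D) : Prop :=
  ∃ k : ℕ → ℕ, StrictMono k ∧ k 0 = 0 ∧ ∀ i, s i ∈ P.Sig (seg t (k i) (k (i + 1)))

/-- `(K, Σ)` is nice. -/
def Nice : Prop :=
  ∀ (t : WeakCreature A D) (l : List (WeakCreature A D)), ∀ s ∈ P.Sig (t :: l),
    P.basis t ⊆ P.basis s

/-- `(K, Σ)` is smooth. -/
def Smooth : Prop :=
  ∀ w t a b, P.FC w t a b → ∀ m, a ≤ m → m < b → ∀ u ∈ P.pos w (seg t a b),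
    u.take (t m).mdn ∈ P.pos w (seg t a m) ∧ u ∈ P.pos (u.take (t m).mdn) (seg t m b)

/-- `(K, Σ)` is finitary. -/
def Finitary : Prop :=
  (∀ m, (H.carrier m).Finite) ∧ ∀ t ∈ P.K, t.val.Finite

/-- `(K, Σ)` is strongly finitary: it is finitary and every `Σ(t_0, …, t_{n-1})` is finite
modulo `∼_Σ`. -/
def StronglyFinitary : Prop :=
  P.Finitary ∧ ∀ l, ∃ F : Set (WeakCreature A D), F.Finite ∧ F ⊆ P.Sig l ∧
    ∀ s ∈ P.Sig l, ∃ r ∈ F, P.Equivalent s r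

/-- `(K, Σ)` is growing. -/
def Growing : Prop :=
  ∀ t a b, P.PFC t a b →
    ∃ s ∈ P.Sig (seg t a b), ∀ i, a ≤ i → i < b → (t i).nor ≤ s.nor

/-- `(K, Σ)` is condensed. -/
def Condensed : Prop :=
  ∀ w t a b, P.FC w t a b → (∀ i, a ≤ i → i < b → 0 < (t i).nor) →
    ∀ r ∈ P.Sig (seg t a b), 0 < r.nor →
      ∃ k, a ≤ k ∧ k < b ∧ ∃ s ∈ P.Sig [t k], ∃ v ∈ P.pos w (seg t a k),
        0 < s.nor ∧ ∀ u ∈ P.pos v [s], ∃ u' ∈ P.pos w [r], u <+: u'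

/-- `(K, Σ)` is omittory; the labels of the creatures `t ⇛ [m₀, m₁)` are given by the rule `e`. -/
structure Omittory (e : ℕ → ℕ → D → D) : Prop where
  zero_pos : ∀ t ∈ P.K, ∀ u ∈ P.basis t, u ++ H.zeros t.mdn t.mup ∈ P.pos u [t] ∧
    ∃ v ∈ P.pos u [t], v.drop t.mdn ≠ H.zeros t.mdn t.mup
  extend_mem : ∀ t a b, P.PFC t a b → ∀ i, a ≤ i → i < b →
    (t i).extend H e (t a).mdn (t (b - 1)).mup ∈ P.Sig (seg t a b)
  pos_extend : ∀ t ∈ P.K, ∀ m₀ m₁, m₀ ≤ t.mdn → t.mup ≤ m₁ → t.extend H e m₀ m₁ ∈ P.K →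
    ∀ u ∈ P.basis (t.extend H e m₀ m₁), ∀ v ∈ P.pos u [t.extend H e m₀ m₁],
      ∀ n, u.length ≤ n → n < v.length → v[n]? ≠ some (H.zero n) → t.mdn ≤ n ∧ n < t.mup

/-- `half` witnesses the weak Halving Property of `(K, Σ)`. -/
def WeakHalving (half : WeakCreature A D → WeakCreature A D) : Prop :=
  (∀ t ∈ P.K, half t ∈ P.Sig [t] ∧ t.nor / 2 ≤ (half t).nor) ∧
    ∀ t₀ ∈ P.K, 2 ≤ t₀.nor → ∀ t ∈ P.Sig [half t₀], 0 < t.nor →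
      ∃ s ∈ P.Sig [t₀], t₀.nor / 2 ≤ s.nor ∧
        ∀ u ∈ P.basis t₀, P.pos u [s] ⊆ P.pos u [t]

end CreatingPair

/-! ## Pre-norms and saturation -/

/-- `N` is a nice pre-norm on (the power set of) `X`. -/
structure IsNicePreNorm {X : Type*} (N : Set X → ℝ≥0) : Prop where
  mono : ∀ B C : Set X, B ⊆ C → N B ≤ N C
  univ_pos : 0 < N Set.univ
  singleton_le : ∀ a, N {a} ≤ 1
  split : ∀ B C : Set X, B ⊆ C → 1 < N C → N C - 1 ≤ N B ∨ N C - 1 ≤ N (C \ B)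

/-- The set `val` of the `(d,u)`-sum of the creatures `t_i`, `a ≤ i < b`.  It does not depend
on `d`. -/
def sumVal (H : Alphabet A) (u : Finset ℕ) (t : ℕ → WeakCreature A D) (a b : ℕ) :
    Set (List A × List A) :=
  {x | H.IsSeq x.1 ∧ H.IsSeq x.2 ∧ x.1.length = (t a).mdn ∧ x.2.length = (t (b - 1)).mup ∧
    x.1 <+: x.2 ∧ x.1 ≠ x.2 ∧
    (∀ i, a ≤ i → i < b → i ∈ u → (x.2.take (t i).mdn, x.2.take (t i).mup) ∈ (t i).val) ∧
    (∀ i, a ≤ i → i < b → i ∉ u → H.ZeroOn x.2 (t i).mdn (t i).mup) ∧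
    ∀ i, a ≤ i → i + 1 < b → H.ZeroOn x.2 (t i).mup (t (i + 1)).mdn}

/-- The `(d,u)`-sum of the creatures `t_i`, `a ≤ i < b`, where
`d(⟨r_i : i ∈ u⟩) = min {N(u), r_i : i ∈ u}` for the nonempty set `u`.  Its label is given
by the rule `c` from `N`, `u` and the labels of the `t_i`. -/
noncomputable def dSum (H : Alphabet A) (c : (Set ℕ → ℝ≥0) → Finset ℕ → ℕ → List D → D)
    (N : Set ℕ → ℝ≥0) (u : Finset ℕ) (t : ℕ → WeakCreature A D) (a b : ℕ) :
    WeakCreature A D where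
  nor := min (N u) (sInf ((fun i => (t i).nor) '' (u : Set ℕ)))
  val := sumVal H u t a b
  dis := c N u a ((seg t a b).map WeakCreature.dis)

namespace CreatingPair

variable {H : Alphabet A} (P : CreatingPair H D)

/-- `(K, Σ)` is saturated with respect to the pre-norm `N` on `ω`; the labels of the sums are given
by the rule `c`.  The elements `d` of `D_N` correspond to the finite nonempty sets `u` with
`N(u) > 0`. -/
def Saturated (c : (Set ℕ → ℝ≥0) → Finset ℕ → ℕ → List D → D) (N : Set ℕ → ℝ≥0) : Prop :=
  ∀ u : Finset ℕ, u.Nonempty → 0 < N u → ∀ t a b, P.PFC t a b → u ⊆ Finset.Ico a b →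
    (∀ i ∈ u, 0 < (t i).nor) →
      dSum H c N u t a b ∈ P.Sig (seg t a b) ∧
      ∀ r ∈ P.Sig [dSum H c N u t a b], 0 < r.nor →
        ∃ (u' : Finset ℕ) (s : ℕ → WeakCreature A D), u'.Nonempty ∧ 0 < N u' ∧ u' ⊆ u ∧
          (∀ i, a ≤ i → i < b → s i ∈ P.Sig [t i]) ∧
          sumVal H u' s a b ⊆ r.val ∧ ∀ i ∈ u', 0 < (s i).nor

/-- `(K, Σ)` is saturated with respect to nice pre-norms with values in `ω`. -/
def SaturatedNiceNat (c : (Set ℕ → ℝ≥0) → Finset ℕ → ℕ → List D → D) : Prop :=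
  ∀ N : Set ℕ → ℝ≥0, IsNicePreNorm N → (∀ u, ∃ n : ℕ, N u = n) → P.Saturated c N

/-- `(⊗₁)`: `val[s] ⊆ val[t]` whenever `s ∈ Σ(t)`. -/
def ValMonotone : Prop := ∀ t ∈ P.K, ∀ s ∈ P.Sig [t], s.val ⊆ t.val

/-- `(⊗₂)`: `s ⇛ [m₀, m₁) ∈ Σ(half(t ⇛ [m₀, m₁)))` whenever `s ∈ Σ(half(t))`. -/
def HalfExtend (e : ℕ → ℕ → D → D) (half : WeakCreature A D → WeakCreature A D) : Prop :=
  ∀ t ∈ P.K, ∀ m₀ m₁, m₀ ≤ t.mdn → t.mup ≤ m₁ → t.extend H e m₀ m₁ ∈ P.K →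
    ∀ s ∈ P.Sig [half t], s.extend H e m₀ m₁ ∈ P.Sig [half (t.extend H e m₀ m₁)]

/-- `(⊕₃)`: `Σ(t ⇛ [m₀, m₁)) = {s ⇛ [m₀, m₁) : s ∈ Σ(t)}` modulo `∼_Σ`. -/
def SigExtend (e : ℕ → ℕ → D → D) : Prop :=
  ∀ t ∈ P.K, ∀ m₀ m₁, m₀ ≤ t.mdn → t.mup ≤ m₁ → t.extend H e m₀ m₁ ∈ P.K →
    (∀ r ∈ P.Sig [t.extend H e m₀ m₁], ∃ s ∈ P.Sig [t], P.Equivalent r (s.extend H e m₀ m₁)) ∧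
    ∀ s ∈ P.Sig [t], ∃ r ∈ P.Sig [t.extend H e m₀ m₁], P.Equivalent r (s.extend H e m₀ m₁)

/-! ## The AB-type -/

/-- `z` is a decision function for `p = (w, t_0, t_1, …)`, `N₀` and `(K, Σ)`.  Only the values of `z`
at pairs from `pos(w, t_0, …, t_{N₀-1}) × PC(K, Σ)` matter. -/
def IsDecisionFunction (w : List A) (t : ℕ → WeakCreature A D) (N₀ : ℕ)
    (z : List A → (ℕ → WeakCreature A D) → List A) : Prop :=
  (∀ v ∈ P.pos w (seg t 0 N₀), ∀ t', P.PC t' →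
    ∃ k, N₀ ≤ k ∧ z v t' ∈ P.pos w (seg t 0 k)) ∧
  ∀ v ∈ P.pos w (seg t 0 N₀), ∀ t', P.PC t' → P.PCLe (fun i => t (N₀ + i)) t' →
    ∃ k, z v t' ∈ P.pos v (seg t' 0 k) ∧
      ∀ t'', P.PC t'' → P.PCLe (fun i => t (N₀ + i)) t'' →
        (∀ i, i < k → P.Equivalent (t'' i) (t' i)) → z v t'' = z v t'

/-- The first condition in the definition of the AB-type. -/
def ABZero : Prop :=
  ∀ t a b, P.PFC t a b → ∀ k, a ≤ k → k < b →
    ∃ s ∈ P.Sig (seg t a b), minNor t a b ≤ s.nor ∧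
      ∀ w, P.FC w t a b → ∀ t' ∈ P.Sig [s], 0 < t'.nor →
        ∃ t'' ∈ P.Sig [t k], 0 < t''.nor ∧
          ∃ u' ∈ P.pos w (seg t a k), ∀ u'' ∈ P.pos u' [t''], ∃ v ∈ P.pos w [t'], u'' <+: v

/-- The second condition in the definition of the AB-type. -/
def ABOne : Prop :=
  ∀ w t, P.Candidate w t → ∀ N₀, (∀ i, N₀ ≤ i → 2 < (t i).nor) →
    ∀ z, P.IsDecisionFunction w t N₀ z →
      ∃ N₁, N₀ < N₁ ∧ ∃ s ∈ P.Sig (seg t N₀ N₁), minNor t N₀ N₁ / 2 ≤ s.nor ∧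
        ∀ v ∈ P.pos w (seg t 0 N₀), ∀ r ∈ P.Sig [s], 0 < r.nor →
          ∃ t', P.PC t' ∧ P.PCLe (fun i => t (N₀ + i)) t' ∧
            (∀ i k l, t' i ∈ P.Sig (seg t (N₀ + k) (N₀ + k + l + 1)) →
              minNor t (N₀ + k) (N₀ + k + l + 1) / 2 ≤ (t' i).nor) ∧
            ∃ v' ∈ P.pos v [r], z v t' <+: v'

/-- `(K, Σ)` is of the AB-type. -/
def ABType : Prop := P.ABZero ∧ P.ABOne

/-! ## The forcing notion -/

/-- The conditions `(w, t_0, t_1, …)` of `Q*_{s∞}(K, Σ)`. -/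
structure QStarSInf where
  w : List A
  t : ℕ → WeakCreature A D
  candidate : P.Candidate w t
  norm : ∀ i : ℕ, (max i (t i).mdn : ℕ) < (t i).nor

theorem Pos.trans {P : CreatingPair H D} {w u v : List A} {l l' : List (WeakCreature A D)}
    (h : P.Pos w l u) (h' : P.Pos u l' v) : P.Pos w (l ++ l') v := by
  induction h' with
  | nil => simpa using h
  | step _ hs hv ih => rw [← List.append_assoc]; exact Pos.step ih hs hv

theorem Pos.refine {P : CreatingPair H D} {w v : List A} {l : List (WeakCreature A D)}
    (h : P.Pos w l v) : ∀ L : List (List (WeakCreature A D)),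
    List.Forall₂ (fun s S => s ∈ P.Sig S) l L → P.Pos w L.flatten v := by
  induction h with
  | nil => intro L hL; cases hL; exact Pos.nil
  | @step l l' u v s _ hs hv ih =>
    intro L hL
    have h1 := List.forall₂_take_append L l l' hL.flip
    have h2 := List.forall₂_drop_append L l l' hL.flip
    have := Pos.step (ih _ h1.flip) (P.sig_trans _ _ h2.flip hs) hv
    rwa [← List.flatten_append, List.take_append_drop] at this

theorem seg_append {X : Type*} (t : ℕ → X) {a b c : ℕ} (hab : a ≤ b) (hbc : b ≤ c) :
    seg t a b ++ seg t b c = seg t a c := by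
  have h := List.range'_append (s := a) (m := b - a) (n := c - b) (step := 1)
  have e1 : a + 1 * (b - a) = b := by omega
  have e2 : b - a + (c - b) = c - a := by omega
  rw [e1, e2] at h
  simp only [seg, ← List.map_append, h]

theorem seg_flatten {X : Type*} (t : ℕ → X) {k : ℕ → ℕ} (hk : StrictMono k) {a b : ℕ}
    (hab : a ≤ b) :
    (seg (fun i => seg t (k i) (k (i + 1))) a b).flatten = seg t (k a) (k b) := by
  induction b, hab using Nat.le_induction with
  | base => simp [seg]
  | succ b hab ih =>
    rw [← seg_append _ hab (Nat.le_succ b), List.flatten_append, ih]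
    have : seg (fun i => seg t (k i) (k (i + 1))) b (b + 1) = [seg t (k b) (k (b + 1))] := by
      simp [seg]
    rw [this]
    simpa using seg_append t (hk.monotone hab) (hk.monotone (Nat.le_succ b))

theorem forall₂_seg {X Y : Type*} {R : X → Y → Prop} {s : ℕ → X} {S : ℕ → Y}
    (h : ∀ i, R (s i) (S i)) (a b : ℕ) : List.Forall₂ R (seg s a b) (seg S a b) := by
  simp only [seg, List.forall₂_map_left_iff, List.forall₂_map_right_iff]
  exact List.forall₂_same.2 fun i _ => h i

/-- The order of `Q*_{s∞}(K, Σ)`; a stronger condition is larger. -/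
instance : Preorder P.QStarSInf where
  le p q := ∃ k : ℕ → ℕ, StrictMono k ∧ q.w ∈ P.pos p.w (seg p.t 0 (k 0)) ∧
    ∀ i, q.t i ∈ P.Sig (seg p.t (k i) (k (i + 1)))
  le_refl p := ⟨id, strictMono_id, by simpa [seg, pos] using Pos.nil, fun i => by
    simpa [seg] using P.sig_self _ (p.candidate i).1⟩
  le_trans p q r := by
    rintro ⟨k, hk, hw, ht⟩ ⟨j, hj, hw', ht'⟩
    have key : ∀ a b, List.Forall₂ (fun s S => s ∈ P.Sig S) (seg q.t a b)
        (seg (fun i => seg p.t (k i) (k (i + 1))) a b) := forall₂_seg ht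
    refine ⟨k ∘ j, hk.comp hj, ?_, fun i => ?_⟩
    · have h1 := Pos.trans hw (Pos.refine hw' _ (key 0 (j 0)))
      rw [seg_flatten p.t hk (Nat.zero_le _),
        seg_append p.t (Nat.zero_le _) (hk.monotone (Nat.zero_le _))] at h1
      exact h1
    · have h2 := P.sig_trans _ _ (key (j i) (j (i + 1))) (ht' i)
      rw [seg_flatten p.t hk (hj.monotone (Nat.le_succ i))] at h2
      exact h2

end CreatingPair

/-! ## Almost bounding forcing notions -/

/-- A name for an element of the Baire space: a set of triples `(n, k, p)`, where `(n, k, p)` puts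
the pair `(n, k)` into (the graph of) the function if `p` is in the generic filter, and such
that every condition forces the result to be a function from `ω` to `ω`. -/
structure BaireName (Q : Type*) [Preorder Q] where
  mem : ℕ → ℕ → Q → Prop
  total : ∀ n p, ∃ q, p ≤ q ∧ ∃ k r, mem n k r ∧ r ≤ q
  functional : ∀ n k k' p p', mem n k p → mem n k' p' → (∃ q, p ≤ q ∧ p' ≤ q) → k = k'

/-- `q ⊩ (∃^∞ n ∈ B)(τ(n) < g(n))`: for every `m` the conditions which put into `τ` a pair `(n, k)`
with `n ∈ B`, `n > m` and `k < g(n)` are dense above `q`. -/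
def BaireName.ForcesInfOften {Q : Type*} [Preorder Q] (τ : BaireName Q) (q : Q) (B : Set ℕ)
    (g : ℕ → ℕ) : Prop :=
  ∀ m : ℕ, ∀ q', q ≤ q' → ∃ q'', q' ≤ q'' ∧
    ∃ n ∈ B, m < n ∧ ∃ k < g n, ∃ r, τ.mem n k r ∧ r ≤ q''

/-- The forcing notion `Q` (where stronger conditions are larger) is almost `ω^ω`-bounding. -/
def AlmostBounding (Q : Type*) [Preorder Q] : Prop :=
  ∀ (τ : BaireName Q) (p : Q), ∃ g : ℕ → ℕ, ∀ B : Set ℕ, B.Infinite →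
    ∃ q, p ≤ q ∧ τ.ForcesInfOften q B g

end Creatures

/-!
**Part 1.** A name `τ` and a condition being given, fusion yields a stronger condition `(w, t)`
such that every tail `(v, t_m, t_{m+1}, …)` decides `τ(m)` as soon as some pure extension of it
does. Apply the second condition of the AB-type to the decision function which follows a pure
extension up to the first possibility at which `τ(m)` is decided: it gives a creature
`s ∈ Σ(t_m, …, t_{n-1})` such that some possibility of every `s' ∈ Σ(s)` with positive norm decides
`τ(m)`. There are only finitely many possibilities below `n`, so they all decide values below one
number `g(m)`, and `g` does not depend on an infinite set `B`. For a given `B`, the first condition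
of the AB-type prolongs such creatures with `m ∈ B` downwards to consecutive blocks, which form a
condition `q`. When a creature of an extension `q'` of `q` is built from blocks, `(K, Σ)` being
condensed gives a successor with positive norm of a single block all of whose possibilities are
initial segments of possibilities of `q'`; one of these decides a value `τ(m) < g(m)` with `m ∈ B`.

**Part 2.** Omitting all creatures but the `k`-th one gives the first condition of the AB-type. For
the second one, halve all creatures and call a set `X ⊆ ω` good if, for every root `v` and all
`s_i ∈ Σ(half(t_i))` with positive norm for `i ∈ X`, some possibility in the sum of the `s_i`,
`i ∈ X`, extends an element `z(v, t')`. Infinite sets are good: omit the creatures outside `X` and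
replace each `s_i` by a creature of large norm with fewer possibilities. As `(K, Σ)` is strongly
finitary, compactness shows that a finite part of `X` is already good. How often a set can be split
with one of the halves remaining good is therefore a nice pre-norm which, again by compactness,
takes arbitrarily large values at finite sets `u`, and saturation shows that the sum of the
`half(t_i)`, `i ∈ u`, is as required.
-/

namespace Creatures

universe u v

/-! ## Pre-norms from splitting ranks -/

theorem exists_uniform_bound {F : ℕ → Type*} [∀ i, Finite (F i)] {R : ℕ → (∀ i, F i) → Prop}
    (hmono : Monotone R) (hdep : ∀ n, DependsOn (R n) (Set.Iio n)) (h : ∀ s, ∃ n, R n s) :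
    ∃ n, ∀ s, R n s := by
  let _ : ∀ i, TopologicalSpace (F i) := fun _ => ⊥
  have : ∀ i, DiscreteTopology (F i) := fun _ => ⟨rfl⟩
  have hopen : ∀ n, IsOpen {s | R n s} := fun n => by
    obtain ⟨R', hR'⟩ := dependsOn_iff_exists_comp.1 (hdep n)
    have hcont : Continuous ((Set.Iio n).domRestrict (π := F)) := by fun_prop
    rw [hR']
    exact (isOpen_discrete {x | R' x}).preimage hcont
  obtain ⟨n, hn⟩ := isCompact_univ.elim_directed_cover _ hopen
    (fun s _ => Set.mem_iUnion.2 (h s)) (directed_of_isDirected_le fun _ _ hij s => hmono hij s)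
  exact ⟨n, fun s => hn (Set.mem_univ s)⟩

theorem exists_uniform_split {G : Set ℕ → Prop} (hG : Monotone G)
    (hGX : ∀ X : Set ℕ, X.Infinite → ∃ n, G (X ∩ Set.Iio n)) {X : Set ℕ} (hX : X.Infinite) :
    ∃ n, ∀ B : Set ℕ, G (X ∩ B ∩ Set.Iio n) ∨ G (X \ B ∩ Set.Iio n) := by
  refine exists_uniform_bound (F := fun _ => Prop)
    (R := fun n (B : Set ℕ) => G (X ∩ B ∩ Set.Iio n) ∨ G (X \ B ∩ Set.Iio n)) ?_ ?_ ?_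
  · refine fun m n hmn B => Or.imp (hG ?_) (hG ?_) <;>
      exact Set.inter_subset_inter_right _ (Set.Iio_subset_Iio hmn)
  · intro n (B : Set ℕ) (C : Set ℕ) (hBC : ∀ i < n, (i ∈ B) = (i ∈ C))
    have hinter : X ∩ B ∩ Set.Iio n = X ∩ C ∩ Set.Iio n := by grind
    have hdiff : X \ B ∩ Set.Iio n = X \ C ∩ Set.Iio n := by grind
    simp only [hinter, hdiff]
  · intro (B : Set ℕ)
    have hXB := hX
    rw [← Set.inter_union_sdiff X B, Set.infinite_union] at hXB
    obtain hXB | hXB := hXB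
    · exact (hGX _ hXB).imp fun _ => Or.inl
    · exact (hGX _ hXB).imp fun _ => Or.inr

/-- The sets of rank at least `k` over a predicate `G`: the nonempty sets satisfying `G` have rank
at least `1`, and a set with at least two elements has rank at least `k + 1 ≥ 2` if one half of
every splitting of it has rank at least `k`. The rank is the source of nice pre-norms. -/
def SplitRank {α : Type*} (G : Set α → Prop) : ℕ → Set α → Prop
  | 0, _ => True
  | 1, u => G u ∧ u.Nonempty
  | k + 2, u => u.Nontrivial ∧ ∀ B ⊆ u, SplitRank G (k + 1) B ∨ SplitRank G (k + 1) (u \ B)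

/-- The largest `k ≤ M` such that `u` has rank at least `k` over `G`. -/
noncomputable def splitNorm {α : Type*} (G : Set α → Prop) (M : ℕ) (u : Set α) : ℕ :=
  open Classical in Nat.findGreatest (fun k => SplitRank G k u) M

section SplitRank

variable {α : Type*} {G : Set α → Prop} {k M : ℕ} {u : Set α}

theorem SplitRank.monotone (hG : Monotone G) : ∀ k, Monotone (SplitRank G k)
  | 0 => fun _ _ _ => id
  | 1 => fun _ _ hBC => And.imp (hG hBC) (Set.Nonempty.mono hBC)
  | k + 2 => fun B C hBC hB => ⟨hB.1.mono hBC, fun E _ =>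
      (hB.2 (E ∩ B) Set.inter_subset_right).imp
        (SplitRank.monotone hG (k + 1) Set.inter_subset_left)
        (SplitRank.monotone hG (k + 1) (by grind))⟩

theorem SplitRank.pred_and_nonempty (h : SplitRank G (k + 1) u) : G u ∧ u.Nonempty := by
  induction k generalizing u with
  | zero => exact h
  | succ k ih =>
    obtain h' | h' := h.2 ∅ (Set.empty_subset u)
    · exact absurd (ih h').2 Set.not_nonempty_empty
    · exact ih (by simpa only [Set.sdiff_empty] using h')

theorem splitRank_splitNorm : SplitRank G (splitNorm G M u) u := by
  classical
  exact Nat.findGreatest_spec (P := fun k => SplitRank G k u) M.zero_le trivial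

theorem le_splitNorm (hk : k ≤ M) (h : SplitRank G k u) : k ≤ splitNorm G M u := by
  classical
  exact Nat.le_findGreatest hk h

theorem splitNorm_le : splitNorm G M u ≤ M := by
  classical
  exact Nat.findGreatest_le M

theorem splitNorm_mono (hG : Monotone G) : Monotone (splitNorm G M) := fun _ _ hBC =>
  le_splitNorm splitNorm_le (SplitRank.monotone hG _ hBC splitRank_splitNorm)

theorem splitNorm_singleton_le (a : α) : splitNorm G M {a} ≤ 1 := by
  by_contra! h
  obtain ⟨k, hk⟩ := Nat.exists_eq_add_of_le' h
  have hrank := splitRank_splitNorm (G := G) (M := M) (u := {a})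
  rw [hk] at hrank
  exact Set.not_nontrivial_singleton hrank.1

theorem splitNorm_split {B : Set α} (hB : B ⊆ u) (hu : 1 < splitNorm G M u) :
    splitNorm G M u ≤ splitNorm G M B + 1 ∨ splitNorm G M u ≤ splitNorm G M (u \ B) + 1 := by
  obtain ⟨k, hk⟩ := Nat.exists_eq_add_of_le' hu
  have hkM : k + 1 ≤ M := by have := splitNorm_le (G := G) (M := M) (u := u); lia
  have hrank := splitRank_splitNorm (G := G) (M := M) (u := u)
  rw [hk] at hrank ⊢
  exact (hrank.2 B hB).imp (fun h => by have := le_splitNorm hkM h; lia)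
    (fun h => by have := le_splitNorm hkM h; lia)

theorem isNicePreNorm_splitNorm (hG : Monotone G) (hpos : 0 < splitNorm G M Set.univ) :
    IsNicePreNorm fun u => (splitNorm G M u : ℝ≥0) where
  mono B C hBC := by exact_mod_cast splitNorm_mono hG hBC
  univ_pos := by exact_mod_cast hpos
  singleton_le a := by exact_mod_cast splitNorm_singleton_le a
  split B C hBC hC := by
    simp only [tsub_le_iff_right]
    exact_mod_cast splitNorm_split hBC (by exact_mod_cast hC)

theorem SplitRank.exists_inter_Iio {G : Set ℕ → Prop} (hG : Monotone G)
    (hGX : ∀ X : Set ℕ, X.Infinite → ∃ n, G (X ∩ Set.Iio n)) :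
    ∀ k {X : Set ℕ}, X.Infinite → ∃ n, SplitRank G k (X ∩ Set.Iio n)
  | 0, _, _ => ⟨0, trivial⟩
  | 1, X, hX => by
    obtain ⟨n, hn⟩ := hGX X hX
    obtain ⟨x, hx⟩ := hX.nonempty
    exact ⟨max n (x + 1), hG (by grind) hn, x, hx, by grind⟩
  | k + 2, X, hX => by
    obtain ⟨n, hn⟩ := exists_uniform_split (SplitRank.monotone hG (k + 1))
      (fun _ hY => exists_inter_Iio hG hGX (k + 1) hY) hX
    obtain ⟨x, hx⟩ := hX.nonempty
    obtain ⟨y, hy, hxy⟩ := hX.exists_gt x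
    refine ⟨max n (y + 1), ⟨x, by grind, y, by grind, hxy.ne⟩, fun B _ => ?_⟩
    exact (hn B).imp (SplitRank.monotone hG _ (by grind)) (SplitRank.monotone hG _ (by grind))

end SplitRank

theorem exists_nicePreNorm {G : Set ℕ → Prop} (hG : Monotone G)
    (hGX : ∀ X : Set ℕ, X.Infinite → ∃ n, G (X ∩ Set.Iio n)) (M : ℕ) :
    ∃ N : Set ℕ → ℝ≥0, IsNicePreNorm N ∧ (∀ u, ∃ n : ℕ, N u = n) ∧
      (∀ u, 0 < N u → G u ∧ u.Nonempty) ∧ ∃ u : Finset ℕ, (M : ℝ≥0) < N u := by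
  obtain ⟨n, hn⟩ := SplitRank.exists_inter_Iio hG hGX (M + 1) Set.infinite_univ
  have hlarge : M < splitNorm G (M + 1) (Finset.range n : Set ℕ) :=
    le_splitNorm le_rfl (by simpa using hn)
  refine ⟨fun u => splitNorm G (M + 1) u, isNicePreNorm_splitNorm hG ?_, fun u => ⟨_, rfl⟩,
    fun u hu => ?_, Finset.range n, Nat.cast_lt.2 hlarge⟩
  · exact (Nat.zero_lt_of_lt hlarge).trans_le (splitNorm_mono hG (Set.subset_univ _))
  · obtain ⟨k, hk⟩ := Nat.exists_eq_add_of_lt (Nat.cast_pos.1 hu)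
    have hrank := splitRank_splitNorm (G := G) (M := M + 1) (u := u)
    rw [hk, Nat.zero_add] at hrank
    exact hrank.pred_and_nonempty

/-! ## Creatures and possibilities -/

theorem seg_self {X : Type*} (t : ℕ → X) (a : ℕ) : seg t a a = [] := by
  simp only [seg, Nat.sub_self, List.range'_zero, List.map_nil]

theorem seg_succ {X : Type*} (t : ℕ → X) (a : ℕ) : seg t a (a + 1) = [t a] := by
  simp only [seg, Nat.add_sub_cancel_left, List.range'_one, List.map_cons, List.map_nil]

theorem seg_succ_right {X : Type*} (t : ℕ → X) {a b : ℕ} (h : a ≤ b) :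
    seg t a (b + 1) = seg t a b ++ [t b] := by
  rw [← seg_succ, CreatingPair.seg_append t h b.le_succ]

theorem seg_cons {X : Type*} (t : ℕ → X) {a b : ℕ} (h : a < b) :
    seg t a b = t a :: seg t (a + 1) b := by
  rw [← CreatingPair.seg_append t a.le_succ h, seg_succ, List.singleton_append]

theorem seg_eq_nil {X : Type*} (t : ℕ → X) {a b : ℕ} (h : b ≤ a) : seg t a b = [] := by
  rw [seg, Nat.sub_eq_zero_of_le h, List.range'_zero, List.map_nil]

theorem seg_ne_nil {X : Type*} (t : ℕ → X) {a b : ℕ} (h : a < b) : seg t a b ≠ [] := by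
  rw [seg_cons t h]
  exact List.cons_ne_nil _ _

theorem seg_shift {X : Type*} (t : ℕ → X) (n a b : ℕ) :
    seg (fun i => t (n + i)) a b = seg t (n + a) (n + b) := by
  rw [seg, seg, Nat.add_sub_add_left, ← List.map_add_range', List.map_map]
  rfl

theorem seg_congr {X : Type*} {s t : ℕ → X} {a b : ℕ} (h : ∀ i, a ≤ i → i < b → s i = t i) :
    seg s a b = seg t a b := by
  refine List.map_congr_left fun i hi => ?_
  rw [List.mem_range'_1] at hi
  exact h i hi.1 (by lia)

theorem head_seg {X : Type*} (t : ℕ → X) {a b : ℕ} (h : a < b) :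
    (seg t a b).head (seg_ne_nil t h) = t a := by
  simp only [seg_cons t h, List.head_cons]

theorem getLast_seg {X : Type*} (t : ℕ → X) {a b : ℕ} (h : a < b) :
    (seg t a b).getLast (seg_ne_nil t h) = t (b - 1) := by
  obtain ⟨c, rfl⟩ := Nat.exists_eq_add_one_of_ne_zero (Nat.ne_zero_of_lt h)
  simp only [seg_succ_right t (Nat.le_of_lt_succ h), List.getLast_append_singleton,
    Nat.add_sub_cancel]

variable {A : Type u} {D : Type v} {H : Alphabet A}

theorem getElem?_of_prefix {w w' : List A} (hw : w <+: w') {i : ℕ} {a : A}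
    (h : w[i]? = some a) : w'[i]? = some a := by
  obtain ⟨l, rfl⟩ := hw
  rw [List.getElem?_append_left (List.getElem?_eq_some_iff.1 h).1, h]

theorem Alphabet.length_zeros (a b : ℕ) : (H.zeros a b).length = b - a := by
  rw [Alphabet.zeros, List.length_map, List.length_range']

theorem Alphabet.zeros_append {a b c : ℕ} (hab : a ≤ b) (hbc : b ≤ c) :
    H.zeros a b ++ H.zeros b c = H.zeros a c :=
  CreatingPair.seg_append H.zero hab hbc

theorem Alphabet.zeroOn_append_zeros {w : List A} {a b : ℕ} (h : w.length = a) :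
    H.ZeroOn (w ++ H.zeros a b) a b := by
  intro i hai hib
  rw [List.getElem?_append_right (by lia), Alphabet.zeros, List.getElem?_map,
    List.getElem?_range' (by lia), Option.map_some]
  congr 2
  lia

theorem Alphabet.IsSeq.append_zeros {w : List A} (hw : H.IsSeq w) {a b : ℕ} (h : w.length = a) :
    H.IsSeq (w ++ H.zeros a b) := by
  intro i x hx
  by_cases hi : i < a
  · rw [List.getElem?_append_left (by lia)] at hx
    exact hw i x hx
  · have hib : i < b := by
      have := (List.getElem?_eq_some_iff.1 hx).1
      rw [List.length_append, H.length_zeros] at this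
      lia
    rw [zeroOn_append_zeros h i (by lia) hib] at hx
    cases hx
    exact H.zero_mem i

theorem Alphabet.ZeroOn.take_eq {w : List A} {a b : ℕ} (h : H.ZeroOn w a b) (hab : a ≤ b)
    (ha : a ≤ w.length) : w.take b = w.take a ++ H.zeros a b := by
  have hla : (w.take a).length = a := List.length_take_of_le ha
  refine List.ext_getElem? fun i => ?_
  by_cases hi : i < a
  · rw [List.getElem?_append_left (by lia), List.getElem?_take_of_lt (by lia),
      List.getElem?_take_of_lt hi]
  by_cases hib : i < b
  · rw [zeroOn_append_zeros hla i (by lia) hib, List.getElem?_take_of_lt hib, h i (by lia) hib]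
  · rw [List.getElem?_eq_none, List.getElem?_eq_none]
    · rw [List.length_append, H.length_zeros]; lia
    · rw [List.length_take]; lia

theorem Alphabet.ZeroOn.mono {w : List A} {a b a' b' : ℕ} (h : H.ZeroOn w a b) (ha : a ≤ a')
    (hb : b' ≤ b) : H.ZeroOn w a' b' :=
  fun i hai hib => h i (ha.trans hai) (hib.trans_le hb)

theorem Alphabet.ZeroOn.of_prefix {w w' : List A} {a b : ℕ} (h : H.ZeroOn w a b) (hw : w <+: w') :
    H.ZeroOn w' a b :=
  fun i hai hib => getElem?_of_prefix hw (h i hai hib)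

theorem Alphabet.finite_isSeq (hH : ∀ m, (H.carrier m).Finite) (n : ℕ) :
    {w : List A | H.IsSeq w ∧ w.length = n}.Finite := by
  have hS : (⋃ m ∈ Finset.range n, H.carrier m).Finite :=
    (Finset.range n).finite_toSet.biUnion fun m _ => hH m
  have : Finite (⋃ m ∈ Finset.range n, H.carrier m) := hS
  refine ((List.finite_length_eq (⋃ m ∈ Finset.range n, H.carrier m) n).image
    (List.map Subtype.val)).subset ?_
  rintro w ⟨hw, hn⟩
  have hwS : ∀ a ∈ w, a ∈ ⋃ m ∈ Finset.range n, H.carrier m := by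
    intro a ha
    obtain ⟨i, hi⟩ := List.mem_iff_getElem?.1 ha
    have hin := (List.getElem?_eq_some_iff.1 hi).1
    exact Set.mem_biUnion (Finset.mem_range.2 (hn ▸ hin)) (hw i a hi)
  lift w to List (⋃ m ∈ Finset.range n, H.carrier m) using hwS
  exact ⟨w, (List.length_map Subtype.val).symm.trans hn, rfl⟩

theorem exists_minNor_eq (t : ℕ → WeakCreature A D) {a b : ℕ} (h : a < b) :
    ∃ i, a ≤ i ∧ i < b ∧ minNor t a b = (t i).nor := by
  have hne : ((fun i => (t i).nor) '' Set.Ico a b).Nonempty := ⟨_, a, ⟨le_rfl, h⟩, rfl⟩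
  obtain ⟨i, hi, he⟩ := hne.csInf_mem ((Set.finite_Ico a b).image _)
  exact ⟨i, hi.1, hi.2, he.symm⟩

theorem minNor_le (t : ℕ → WeakCreature A D) {a b i : ℕ} (ha : a ≤ i) (hb : i < b) :
    minNor t a b ≤ (t i).nor :=
  csInf_le (OrderBot.bddBelow _) ⟨i, ⟨ha, hb⟩, rfl⟩

theorem minNor_div_two_le {s t : ℕ → WeakCreature A D} {a b : ℕ} (hab : a < b)
    (h : ∀ i, (t i).nor / 2 ≤ (s i).nor) : minNor t a b / 2 ≤ minNor s a b := by
  obtain ⟨i, hi, hib, hmin⟩ := exists_minNor_eq s hab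
  rw [hmin]
  refine le_trans ?_ (h i)
  gcongr
  exact minNor_le t hi hib

theorem minNor_shift (t : ℕ → WeakCreature A D) (n a b : ℕ) :
    minNor (fun i => t (n + i)) a b = minNor t (n + a) (n + b) := by
  rw [minNor, minNor, ← Set.image_const_add_Ico, Set.image_image]

namespace CreatingPair

variable {P : CreatingPair H D}

theorem length_fst_of_mem_val {t : WeakCreature A D} (ht : t ∈ P.K) {x y : List A}
    (h : (x, y) ∈ t.val) : x.length = t.mdn :=
  ((P.isCreature t ht).2 _ h).1

theorem length_snd_of_mem_val {t : WeakCreature A D} (ht : t ∈ P.K) {x y : List A}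
    (h : (x, y) ∈ t.val) : y.length = t.mup :=
  ((P.isCreature t ht).2 _ h).2

theorem isSeq_fst_of_mem_val {t : WeakCreature A D} (ht : t ∈ P.K) {x y : List A}
    (h : (x, y) ∈ t.val) : H.IsSeq x :=
  ((P.isCreature t ht).1.2 x y h).1

theorem isSeq_snd_of_mem_val {t : WeakCreature A D} (ht : t ∈ P.K) {x y : List A}
    (h : (x, y) ∈ t.val) : H.IsSeq y :=
  ((P.isCreature t ht).1.2 x y h).2.1

theorem prefix_of_mem_val {t : WeakCreature A D} (ht : t ∈ P.K) {x y : List A}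
    (h : (x, y) ∈ t.val) : x <+: y :=
  ((P.isCreature t ht).1.2 x y h).2.2.1

theorem mdn_lt_mup {t : WeakCreature A D} (ht : t ∈ P.K) : t.mdn < t.mup := by
  obtain ⟨⟨x, y⟩, hxy⟩ := (P.isCreature t ht).1.1
  have hpre := prefix_of_mem_val ht hxy
  rw [← length_fst_of_mem_val ht hxy, ← length_snd_of_mem_val ht hxy]
  exact hpre.length_le.lt_of_ne fun h =>
    ((P.isCreature t ht).1.2 x y hxy).2.2.2 (hpre.eq_of_length h)

theorem mdn_of_mem_sig {t s : WeakCreature A D} (h : s ∈ P.Sig [t]) : s.mdn = t.mdn :=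
  P.sig_mdn [t] (List.cons_ne_nil _ _) s h

theorem mup_of_mem_sig {t s : WeakCreature A D} (h : s ∈ P.Sig [t]) : s.mup = t.mup :=
  P.sig_mup [t] (List.cons_ne_nil _ _) s h

theorem mem_K_of_mem_sig {t s : WeakCreature A D} (h : s ∈ P.Sig [t]) : t ∈ P.K :=
  P.mem_of_sig _ ⟨s, h⟩ t (List.mem_singleton_self t)

theorem ne_nil_of_mem_sig {s : WeakCreature A D} {l : List (WeakCreature A D)}
    (h : s ∈ P.Sig l) : l ≠ [] := by
  rintro rfl
  rwa [P.sig_nil] at h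

theorem mem_sig_of_mem_sig_singleton {t s : WeakCreature A D} {l : List (WeakCreature A D)}
    (h : s ∈ P.Sig l) (ht : t ∈ P.Sig [s]) : t ∈ P.Sig l := by
  have hl : [l].flatten = l := List.flatten_singleton
  rw [← hl]
  exact P.sig_trans [s] [l] (.cons h .nil) ht

theorem Equivalent.symm {s t : WeakCreature A D} (h : P.Equivalent s t) : P.Equivalent t s :=
  ⟨h.2.1, h.1, h.2.2.1.symm, h.2.2.2.1.symm, fun l l' => (h.2.2.2.2 l l').symm⟩

theorem Equivalent.sig_singleton {s t : WeakCreature A D} (h : P.Equivalent s t) :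
    P.Sig [s] = P.Sig [t] :=
  h.2.2.2.2 [] []

theorem Equivalent.mem_sig {s t : WeakCreature A D} (h : P.Equivalent s t)
    {l : List (WeakCreature A D)} (hs : s ∈ P.Sig l) : t ∈ P.Sig l :=
  mem_sig_of_mem_sig_singleton hs (h.sig_singleton ▸ P.sig_self t h.2.1)

theorem length_of_mem_basis {t : WeakCreature A D} {w : List A} (h : w ∈ P.basis t) :
    w.length = t.mdn := by
  obtain ⟨s, hs, u, hu⟩ := h
  exact (length_fst_of_mem_val (P.sig_subset _ hs) hu).trans (mdn_of_mem_sig hs)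

theorem isSeq_of_mem_basis {t : WeakCreature A D} {w : List A} (h : w ∈ P.basis t) :
    H.IsSeq w := by
  obtain ⟨s, hs, u, hu⟩ := h
  exact isSeq_fst_of_mem_val (P.sig_subset _ hs) hu

theorem Nice.basis_seg (hn : P.Nice) {s : WeakCreature A D} {t : ℕ → WeakCreature A D} {a b : ℕ}
    (hs : s ∈ P.Sig (seg t a b)) (hab : a < b) : P.basis (t a) ⊆ P.basis s := by
  rw [seg_cons t hab] at hs
  exact hn _ _ s hs

theorem Pos.prefix {w u : List A} {l : List (WeakCreature A D)} (h : P.Pos w l u) : w <+: u := by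
  induction h with
  | nil => exact List.prefix_rfl
  | step _ hs hv ih => exact ih.trans (prefix_of_mem_val (P.sig_subset _ hs) hv)

theorem Pos.isSeq {w u : List A} {l : List (WeakCreature A D)} (h : P.Pos w l u)
    (hw : H.IsSeq w) : H.IsSeq u := by
  cases h with
  | nil => exact hw
  | step _ hs hv => exact isSeq_snd_of_mem_val (P.sig_subset _ hs) hv

theorem Pos.length_eq {w u : List A} {l : List (WeakCreature A D)} (h : P.Pos w l u)
    (hl : l ≠ []) : u.length = (l.getLast hl).mup := by
  cases h with
  | nil => exact absurd rfl hl
  | @step l l' u v s _ hs hv =>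
    have hl' := ne_nil_of_mem_sig hs
    rw [length_snd_of_mem_val (P.sig_subset _ hs) hv, P.sig_mup l' hl' s hs,
      List.getLast_append_of_ne_nil _ hl']

theorem mem_pos_nil {w u : List A} : u ∈ P.pos w [] ↔ u = w := by
  refine ⟨fun h => ?_, fun h => h ▸ Pos.nil⟩
  generalize hl : ([] : List (WeakCreature A D)) = l at h
  cases h with
  | nil => rfl
  | step _ hs _ => exact absurd (List.append_eq_nil_iff.1 hl.symm).2 (ne_nil_of_mem_sig hs)

theorem mem_pos_seg_self {w : List A} {t : ℕ → WeakCreature A D} (a : ℕ) :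
    w ∈ P.pos w (seg t a a) := by
  rw [seg_self, mem_pos_nil]

theorem mem_pos_singleton {w u : List A} {t : WeakCreature A D} :
    u ∈ P.pos w [t] ↔ ∃ s ∈ P.Sig [t], (w, u) ∈ s.val := by
  refine ⟨fun h => ?_, fun ⟨s, hs, hv⟩ => Pos.step (l := []) Pos.nil hs hv⟩
  generalize hl : [t] = l at h
  cases h with
  | nil => exact absurd hl (List.cons_ne_nil _ _)
  | @step l l' u v s hu hs hv =>
    obtain ⟨rfl, rfl⟩ | ⟨rfl, rfl⟩ := List.append_eq_singleton_iff.1 hl.symm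
    · rw [mem_pos_nil.1 hu] at hv
      exact ⟨s, hs, hv⟩
    · exact absurd rfl (ne_nil_of_mem_sig hs)

theorem mem_pos_of_mem_val {w u : List A} {t : WeakCreature A D} (ht : t ∈ P.K)
    (h : (w, u) ∈ t.val) : u ∈ P.pos w [t] :=
  mem_pos_singleton.2 ⟨t, P.sig_self t ht, h⟩

theorem mem_pos_of_mem_sig {w u : List A} {s : WeakCreature A D} {l : List (WeakCreature A D)}
    (hs : s ∈ P.Sig l) (h : u ∈ P.pos w [s]) : u ∈ P.pos w l := by
  have hl : [l].flatten = l := List.flatten_singleton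
  rw [← hl]
  exact Pos.refine h [l] (.cons hs .nil)

theorem ValMonotone.mem_val_of_mem_pos (hv : P.ValMonotone) {w u : List A} {t : WeakCreature A D}
    (h : u ∈ P.pos w [t]) : (w, u) ∈ t.val := by
  obtain ⟨s, hs, hsv⟩ := mem_pos_singleton.1 h
  exact hv t (mem_K_of_mem_sig hs) s hs hsv

theorem exists_mem_pos_of_mem_basis {w : List A} {t : WeakCreature A D} (h : w ∈ P.basis t) :
    ∃ u, u ∈ P.pos w [t] := by
  obtain ⟨s, hs, u, hu⟩ := h
  exact ⟨u, mem_pos_singleton.2 ⟨s, hs, hu⟩⟩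

theorem mem_pos_append {w u v : List A} {t : ℕ → WeakCreature A D} {a b c : ℕ} (hab : a ≤ b)
    (hbc : b ≤ c) (hu : u ∈ P.pos w (seg t a b)) (hv : v ∈ P.pos u (seg t b c)) :
    v ∈ P.pos w (seg t a c) := by
  rw [← seg_append t hab hbc]
  exact Pos.trans hu hv

theorem mem_pos_succ {w u v : List A} {t : ℕ → WeakCreature A D} {a b : ℕ} (hab : a ≤ b)
    (hu : u ∈ P.pos w (seg t a b)) (hv : v ∈ P.pos u [t b]) : v ∈ P.pos w (seg t a (b + 1)) := by
  rw [seg_succ_right t hab]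
  exact Pos.trans hu hv

theorem mem_pos_of_mem_pos_refinement {w u : List A} {s t : ℕ → WeakCreature A D} {k : ℕ → ℕ}
    (hk : StrictMono k) (hs : ∀ i, s i ∈ P.Sig (seg t (k i) (k (i + 1)))) {a b : ℕ} (hab : a ≤ b)
    (hu : u ∈ P.pos w (seg s a b)) : u ∈ P.pos w (seg t (k a) (k b)) := by
  rw [← seg_flatten t hk hab]
  exact Pos.refine hu _ (forall₂_seg (R := fun s S => s ∈ P.Sig S) hs a b)

theorem mem_sig_of_mem_sig_refinement {r : WeakCreature A D} {s t : ℕ → WeakCreature A D}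
    {k : ℕ → ℕ} (hk : StrictMono k) (hs : ∀ i, s i ∈ P.Sig (seg t (k i) (k (i + 1)))) {a b : ℕ}
    (hab : a ≤ b) (hr : r ∈ P.Sig (seg s a b)) : r ∈ P.Sig (seg t (k a) (k b)) := by
  rw [← seg_flatten t hk hab]
  exact P.sig_trans _ _ (forall₂_seg (R := fun s S => s ∈ P.Sig S) hs a b) hr

theorem pos_seg_subset_of_mem_sig {w : List A} {s t : ℕ → WeakCreature A D} {a b : ℕ}
    (hs : ∀ i, a ≤ i → i < b → s i ∈ P.Sig [t i]) :
    P.pos w (seg s a b) ⊆ P.pos w (seg t a b) := by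
  intro u hu
  have hflat : P.Pos w ((seg t a b).map fun r => [r]).flatten u := by
    refine Pos.refine hu _ ?_
    rw [seg, seg, List.map_map, List.forall₂_map_left_iff, List.forall₂_map_right_iff,
      List.forall₂_same]
    intro j hj
    rw [List.mem_range'_1] at hj
    exact hs j hj.1 (by lia)
  rwa [← List.flatMap_def, List.flatMap_singleton'] at hflat

/-- The sequences of elements of `K` each of which begins where the previous one ends, that is, the
pure candidates without the requirement on possibilities. -/
def Linked (P : CreatingPair H D) (t : ℕ → WeakCreature A D) : Prop :=
  ∀ i, t i ∈ P.K ∧ (t i).mup = (t (i + 1)).mdn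

theorem Linked.strictMono {t : ℕ → WeakCreature A D} (ht : P.Linked t) :
    StrictMono fun i => (t i).mdn :=
  strictMono_nat_of_lt_succ fun i => (mdn_lt_mup (ht i).1).trans_eq (ht i).2

theorem Linked.shift {t : ℕ → WeakCreature A D} (ht : P.Linked t) (n : ℕ) :
    P.Linked fun i => t (n + i) :=
  fun i => ht (n + i)

theorem Linked.mup_pred {t : ℕ → WeakCreature A D} (ht : P.Linked t) {a b : ℕ} (hab : a < b) :
    (t (b - 1)).mup = (t b).mdn := by
  rw [(ht (b - 1)).2, Nat.sub_add_cancel (Nat.one_le_of_lt hab)]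

theorem lt_of_mem_sig_seg {t : ℕ → WeakCreature A D} {a b : ℕ} {s : WeakCreature A D}
    (hs : s ∈ P.Sig (seg t a b)) : a < b := by
  by_contra! h
  exact ne_nil_of_mem_sig hs (seg_eq_nil t h)

theorem mdn_of_mem_sig_seg {t : ℕ → WeakCreature A D} {a b : ℕ} {s : WeakCreature A D}
    (hs : s ∈ P.Sig (seg t a b)) : s.mdn = (t a).mdn := by
  have hab := lt_of_mem_sig_seg hs
  rw [P.sig_mdn _ (seg_ne_nil t hab) s hs, head_seg t hab]

theorem Linked.mup_of_mem_sig {t : ℕ → WeakCreature A D} (ht : P.Linked t) {a b : ℕ}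
    {s : WeakCreature A D} (hs : s ∈ P.Sig (seg t a b)) : s.mup = (t b).mdn := by
  have hab := lt_of_mem_sig_seg hs
  rw [P.sig_mup _ (seg_ne_nil t hab) s hs, getLast_seg t hab, ht.mup_pred hab]

theorem Linked.length_of_mem_pos {t : ℕ → WeakCreature A D} (ht : P.Linked t) {w u : List A}
    {a b : ℕ} (hw : w.length = (t a).mdn) (hab : a ≤ b) (hu : u ∈ P.pos w (seg t a b)) :
    u.length = (t b).mdn := by
  obtain rfl | hab := hab.eq_or_lt
  · rw [seg_self, mem_pos_nil] at hu
    rw [hu, hw]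
  · rw [Pos.length_eq hu (seg_ne_nil t hab), getLast_seg t hab, ht.mup_pred hab]

theorem Linked.refine {s t : ℕ → WeakCreature A D} (ht : P.Linked t) {k : ℕ → ℕ}
    (hs : ∀ i, s i ∈ P.Sig (seg t (k i) (k (i + 1)))) : P.Linked s := fun i =>
  ⟨P.sig_subset _ (hs i), (ht.mup_of_mem_sig (hs i)).trans (mdn_of_mem_sig_seg (hs (i + 1))).symm⟩

theorem Candidate.linked {w : List A} {t : ℕ → WeakCreature A D} (h : P.Candidate w t) :
    P.Linked t :=
  fun i => ⟨(h i).1, (h i).2.1⟩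

theorem Candidate.length_eq {w : List A} {t : ℕ → WeakCreature A D} (h : P.Candidate w t) :
    w.length = (t 0).mdn :=
  length_of_mem_basis ((h 0).2.2 (mem_pos_seg_self 0))

theorem Candidate.isSeq {w : List A} {t : ℕ → WeakCreature A D} (h : P.Candidate w t) :
    H.IsSeq w :=
  isSeq_of_mem_basis ((h 0).2.2 (mem_pos_seg_self 0))

theorem Candidate.length_of_mem_pos {w u : List A} {t : ℕ → WeakCreature A D}
    (h : P.Candidate w t) {n : ℕ} (hu : u ∈ P.pos w (seg t 0 n)) : u.length = (t n).mdn :=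
  h.linked.length_of_mem_pos h.length_eq n.zero_le hu

theorem Candidate.pos_nonempty {w : List A} {t : ℕ → WeakCreature A D} (h : P.Candidate w t)
    (n : ℕ) : (P.pos w (seg t 0 n)).Nonempty := by
  induction n with
  | zero => exact ⟨w, mem_pos_seg_self 0⟩
  | succ n ih =>
    obtain ⟨u, hu⟩ := ih
    obtain ⟨v, hv⟩ := exists_mem_pos_of_mem_basis ((h n).2.2 hu)
    exact ⟨v, mem_pos_succ n.zero_le hu hv⟩

theorem Candidate.refine (hn : P.Nice) {w v : List A} {s t : ℕ → WeakCreature A D}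
    (h : P.Candidate w t) {k : ℕ → ℕ} (hk : StrictMono k)
    (hs : ∀ i, s i ∈ P.Sig (seg t (k i) (k (i + 1)))) (hv : v ∈ P.pos w (seg t 0 (k 0))) :
    P.Candidate v s := fun i => by
  refine ⟨(h.linked.refine hs i).1, (h.linked.refine hs i).2, fun u hu => ?_⟩
  have hu' := mem_pos_of_mem_pos_refinement hk hs i.zero_le hu
  exact hn.basis_seg (hs i) (hk i.lt_succ_self)
    ((h _).2.2 (mem_pos_append (Nat.zero_le _) (hk.monotone i.zero_le) hv hu'))

theorem Candidate.tail (hn : P.Nice) {w v : List A} {t : ℕ → WeakCreature A D}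
    (h : P.Candidate w t) {n : ℕ} (hv : v ∈ P.pos w (seg t 0 n)) :
    P.Candidate v fun i => t (n + i) :=
  h.refine hn (k := fun i => n + i) (strictMono_id.const_add n)
    (fun i => by rw [← add_assoc, seg_succ]; exact P.sig_self _ (h _).1) hv

theorem Candidate.fc {w v : List A} {t : ℕ → WeakCreature A D} (h : P.Candidate w t) {a b : ℕ}
    (hab : a < b) (hv : v ∈ P.pos w (seg t 0 a)) : P.FC v t a b :=
  ⟨hab, fun i hai _ => ⟨(h i).1, fun _ hu => (h i).2.2 (mem_pos_append a.zero_le hai hv hu)⟩,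
    fun i _ _ => (h i).2.1⟩

theorem Candidate.pfc {w : List A} {t : ℕ → WeakCreature A D} (h : P.Candidate w t) {a b : ℕ}
    (hab : a < b) : P.PFC t a b :=
  (h.pos_nonempty a).imp fun _ hv => h.fc hab hv

theorem Finitary.finite_pos (hf : P.Finitary) {w : List A} {t : ℕ → WeakCreature A D}
    (h : P.Candidate w t) (n : ℕ) : (P.pos w (seg t 0 n)).Finite :=
  (H.finite_isSeq hf.1 (t n).mdn).subset fun _ hu => ⟨Pos.isSeq hu h.isSeq, h.length_of_mem_pos hu⟩

theorem PCLe.refl {t : ℕ → WeakCreature A D} (h : ∀ i, t i ∈ P.K) : P.PCLe t t :=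
  ⟨id, strictMono_id, rfl, fun i => by simpa only [id, seg_succ] using P.sig_self _ (h i)⟩

theorem PCLe.trans {r s t : ℕ → WeakCreature A D} (h : P.PCLe t s) (h' : P.PCLe s r) :
    P.PCLe t r := by
  obtain ⟨k, hk, hk0, hs⟩ := h
  obtain ⟨j, hj, hj0, hr⟩ := h'
  exact ⟨k ∘ j, hk.comp hj, by rw [Function.comp_apply, hj0, hk0],
    fun i => mem_sig_of_mem_sig_refinement hk hs (hj.monotone i.le_succ) (hr i)⟩

theorem PCLe.linked {s t : ℕ → WeakCreature A D} (h : P.PCLe t s) (ht : P.Linked t) :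
    P.Linked s := by
  obtain ⟨k, _, _, hs⟩ := h
  exact ht.refine hs

theorem PCLe.mdn_zero {s t : ℕ → WeakCreature A D} (h : P.PCLe t s) :
    (s 0).mdn = (t 0).mdn := by
  obtain ⟨k, _, hk0, hs⟩ := h
  rw [mdn_of_mem_sig_seg (hs 0), hk0]

theorem PCLe.of_forall_mem_sig {s t : ℕ → WeakCreature A D} (ht : P.Linked t) (hs : P.Linked s)
    (h0 : (s 0).mdn = (t 0).mdn) (h : ∀ i, ∃ a b, s i ∈ P.Sig (seg t a b)) : P.PCLe t s := by
  choose a b hab using h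
  have hb : ∀ i, b i = a (i + 1) := fun i => ht.strictMono.injective <| by
    simp only [← ht.mup_of_mem_sig (hab i), ← mdn_of_mem_sig_seg (hab (i + 1)), (hs i).2]
  refine ⟨a, strictMono_nat_of_lt_succ fun i => ?_, ht.strictMono.injective ?_, fun i => ?_⟩
  · rw [← hb]; exact lt_of_mem_sig_seg (hab i)
  · simp only [← mdn_of_mem_sig_seg (hab 0), h0]
  · rw [← hb]; exact hab i

theorem Candidate.pcle (hn : P.Nice) {w : List A} {s t : ℕ → WeakCreature A D}
    (h : P.Candidate w t) (hs : P.PCLe t s) : P.Candidate w s := by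
  obtain ⟨k, hk, hk0, hs⟩ := hs
  exact h.refine hn hk hs (by rw [hk0]; exact mem_pos_seg_self 0)

theorem FC.mdn_le_mdn {w : List A} {t : ℕ → WeakCreature A D} {a b : ℕ} (h : P.FC w t a b)
    {i j : ℕ} (hai : a ≤ i) (hij : i ≤ j) (hjb : j < b) : (t i).mdn ≤ (t j).mdn := by
  induction j, hij using Nat.le_induction with
  | base => exact le_rfl
  | succ j hij ih =>
    rw [← h.2.2 j (hai.trans hij) hjb]
    exact (ih (by lia)).trans (mdn_lt_mup (h.2.1 j (hai.trans hij) (by lia)).1).le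

theorem FC.mup_le_mup {w : List A} {t : ℕ → WeakCreature A D} {a b : ℕ} (h : P.FC w t a b)
    {i j : ℕ} (hai : a ≤ i) (hij : i ≤ j) (hjb : j < b) : (t i).mup ≤ (t j).mup := by
  obtain rfl | hij := hij.eq_or_lt
  · exact le_rfl
  · rw [h.2.2 i hai (by lia)]
    exact (h.mdn_le_mdn (by lia) hij hjb).trans (mdn_lt_mup (h.2.1 j (by lia) hjb).1).le

theorem FC.length_eq {w : List A} {t : ℕ → WeakCreature A D} {a b : ℕ} (h : P.FC w t a b) :
    w.length = (t a).mdn :=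
  length_of_mem_basis ((h.2.1 a le_rfl h.1).2 (mem_pos_seg_self a))

theorem FC.isSeq {w : List A} {t : ℕ → WeakCreature A D} {a b : ℕ} (h : P.FC w t a b) :
    H.IsSeq w :=
  isSeq_of_mem_basis ((h.2.1 a le_rfl h.1).2 (mem_pos_seg_self a))

theorem FC.length_of_mem_pos {w u : List A} {t : ℕ → WeakCreature A D} {a b : ℕ}
    (h : P.FC w t a b) (hu : u ∈ P.pos w (seg t a b)) : u.length = (t (b - 1)).mup := by
  rw [Pos.length_eq hu (seg_ne_nil t h.1), getLast_seg t h.1]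

theorem FC.restrict {w : List A} {t : ℕ → WeakCreature A D} {a b c : ℕ} (h : P.FC w t a b)
    (hac : a < c) (hcb : c ≤ b) : P.FC w t a c :=
  ⟨hac, fun i hai hic => h.2.1 i hai (hic.trans_le hcb),
    fun i hai hic => h.2.2 i hai (hic.trans_le hcb)⟩

theorem FC.of_mem_sig (hn : P.Nice) {w : List A} {s t : ℕ → WeakCreature A D} {a b : ℕ}
    (h : P.FC w t a b) (hs : ∀ i, a ≤ i → i < b → s i ∈ P.Sig [t i]) : P.FC w s a b := by
  refine ⟨h.1, fun i hai hib => ⟨P.sig_subset _ (hs i hai hib), fun u hu => ?_⟩,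
    fun i hai hib => ?_⟩
  · exact hn _ _ _ (hs i hai hib) ((h.2.1 i hai hib).2
      (pos_seg_subset_of_mem_sig (fun j haj hji => hs j haj (hji.trans hib)) hu))
  · rw [mup_of_mem_sig (hs i hai (by lia)), h.2.2 i hai hib,
      mdn_of_mem_sig (hs (i + 1) (by lia) hib)]

theorem Smooth.mem_val_of_mem_pos (hs : P.Smooth) (hv : P.ValMonotone) {w u : List A}
    {t : ℕ → WeakCreature A D} {a b : ℕ} (h : P.FC w t a b) (hu : u ∈ P.pos w (seg t a b)) {i : ℕ}
    (hai : a ≤ i) (hib : i < b) : (u.take (t i).mdn, u.take (t i).mup) ∈ (t i).val := by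
  have hui : u.take (t i).mup ∈ P.pos w (seg t a (i + 1)) := by
    obtain rfl | hib := (Nat.succ_le_of_lt hib).eq_or_lt
    · have hlen := h.length_of_mem_pos hu
      rw [Nat.succ_sub_one] at hlen
      rwa [← hlen, List.take_length]
    · rw [h.2.2 i hai hib]
      exact (hs w t a b h (i + 1) (by lia) hib u hu).1
  have hpos := (hs w t a (i + 1) (h.restrict (by lia) hib) i hai i.lt_succ_self _ hui).2
  rw [seg_succ, List.take_take, min_eq_left (mdn_lt_mup (h.2.1 i hai hib).1).le] at hpos
  exact hv.mem_val_of_mem_pos hpos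

/-! ## Omittory creating pairs -/

theorem Omittory.append_zeros_mem_pos {e : ℕ → ℕ → D → D} (ho : P.Omittory e) {w : List A}
    {t : ℕ → WeakCreature A D} {a b : ℕ} (h : P.FC w t a b) {i : ℕ} (hai : a ≤ i) (hib : i < b) :
    w ++ H.zeros (t a).mdn (t i).mdn ∈ P.pos w (seg t a i) := by
  induction i, hai using Nat.le_induction with
  | base =>
    rw [Alphabet.zeros, Nat.sub_self, List.range'_zero, List.map_nil, List.append_nil]
    exact mem_pos_seg_self a
  | succ i hai ih =>
    have hib : i < b := by lia
    obtain ⟨hK, hbasis⟩ := h.2.1 i hai hib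
    have hzero := (ho.zero_pos _ hK _ (hbasis (ih hib))).1
    rw [List.append_assoc, H.zeros_append (h.mdn_le_mdn le_rfl hai hib) (mdn_lt_mup hK).le,
      h.2.2 i hai (by lia)] at hzero
    exact mem_pos_succ hai (ih hib) hzero

theorem Omittory.growing {e : ℕ → ℕ → D → D} (ho : P.Omittory e) : P.Growing := by
  intro t a b h
  obtain ⟨w, hw⟩ := id h
  obtain ⟨i, hi, hmax⟩ := (Finset.Ico a b).exists_max_image (fun i => (t i).nor)
    ⟨a, Finset.left_mem_Ico.2 hw.1⟩
  rw [Finset.mem_Ico] at hi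
  exact ⟨_, ho.extend_mem t a b h i hi.1 hi.2,
    fun j haj hjb => hmax j (Finset.mem_Ico.2 ⟨haj, hjb⟩)⟩

theorem mem_val_extend {e : ℕ → ℕ → D → D} {t : WeakCreature A D} (ht : t ∈ P.K) {m₀ m₁ : ℕ}
    (hm₀ : m₀ ≤ t.mdn) (hm₁ : t.mup ≤ m₁) {w u : List A} (hw : H.IsSeq w) (hlen : w.length = m₀)
    (hu : (w ++ H.zeros m₀ t.mdn, u) ∈ t.val) :
    (w, u ++ H.zeros t.mup m₁) ∈ (t.extend H e m₀ m₁).val := by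
  have hlt := mdn_lt_mup ht
  have hlenv := length_fst_of_mem_val ht hu
  have hlenu := length_snd_of_mem_val ht hu
  have hpre := prefix_of_mem_val ht hu
  have hlen' : (u ++ H.zeros t.mup m₁).length = m₁ := by
    rw [List.length_append, H.length_zeros]; lia
  have hup : (u ++ H.zeros t.mup m₁).take t.mup = u := by rw [← hlenu, List.take_left]
  have hdn : (u ++ H.zeros t.mup m₁).take t.mdn = w ++ H.zeros m₀ t.mdn := by
    rw [List.take_append_of_le_length (by lia)]
    have htake := List.prefix_iff_eq_take.1 hpre
    rw [hlenv] at htake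
    exact htake.symm
  refine ⟨hw, (isSeq_snd_of_mem_val ht hu).append_zeros hlenu, hlen, hlen', ?_, ?_, ?_, ?_,
    Alphabet.zeroOn_append_zeros hlenu⟩
  · exact ((List.prefix_append _ _).trans hpre).trans (List.prefix_append _ _)
  · rintro (heq : w = u ++ H.zeros t.mup m₁)
    rw [← heq] at hlen'
    lia
  · simpa only [hup, hdn] using hu
  · exact (Alphabet.zeroOn_append_zeros hlen).of_prefix (hpre.trans (List.prefix_append _ _))

theorem Omittory.abZero {e : ℕ → ℕ → D → D} (ho : P.Omittory e) (hv : P.ValMonotone)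
    (he : P.SigExtend e) : P.ABZero := by
  intro t a b hp k hak hkb
  have hs := ho.extend_mem t a b hp k hak hkb
  refine ⟨_, hs, minNor_le t hak hkb, fun w hw t' ht' hpos => ?_⟩
  have hdn := hw.mdn_le_mdn le_rfl hak hkb
  have hup := hw.mup_le_mup hak (Nat.le_sub_one_of_lt hkb) (by lia)
  obtain ⟨t'', ht'', heq⟩ :=
    (he (t k) (hw.2.1 k hak hkb).1 _ _ hdn hup (P.sig_subset _ hs)).1 t' ht'
  refine ⟨t'', ht'', hpos.trans_eq heq.2.2.1, _, ho.append_zeros_mem_pos hw hak hkb,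
    fun u hu => ⟨u ++ H.zeros t''.mup (t (b - 1)).mup, mem_pos_of_mem_val heq.1 ?_,
      List.prefix_append _ _⟩⟩
  rw [← mdn_of_mem_sig ht''] at hdn hu
  rw [← mup_of_mem_sig ht''] at hup
  rw [heq.2.2.2.1]
  exact mem_val_extend (P.sig_subset _ ht'') hdn hup hw.isSeq hw.length_eq
    (hv.mem_val_of_mem_pos hu)

theorem sumVal_subset_sumVal {U : Finset ℕ} {s t : ℕ → WeakCreature A D} {a b : ℕ} (hab : a < b)
    (hdn : ∀ i, a ≤ i → i < b → (s i).mdn = (t i).mdn)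
    (hup : ∀ i, a ≤ i → i < b → (s i).mup = (t i).mup)
    (hval : ∀ i ∈ U, a ≤ i → i < b → (s i).val ⊆ (t i).val) :
    sumVal H U s a b ⊆ sumVal H U t a b := by
  rintro x ⟨hx₁, hx₂, hlen₁, hlen₂, hpre, hne, hmem, hzero, hgap⟩
  refine ⟨hx₁, hx₂, hlen₁.trans (hdn a le_rfl hab), hlen₂.trans (hup _ (by lia) (by lia)), hpre,
    hne, fun i hai hib hi => ?_, fun i hai hib hi => ?_, fun i hai hib => ?_⟩
  · rw [← hdn i hai hib, ← hup i hai hib]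
    exact hval i hi hai hib (hmem i hai hib hi)
  · rw [← hdn i hai hib, ← hup i hai hib]
    exact hzero i hai hib hi
  · rw [← hup i hai (by lia), ← hdn (i + 1) (by lia) hib]
    exact hgap i hai hib

theorem Omittory.mem_val_of_mem_sumVal {e : ℕ → ℕ → D → D} (ho : P.Omittory e)
    (hv : P.ValMonotone) {w x : List A} {U : Finset ℕ} {s : ℕ → WeakCreature A D} {a b : ℕ}
    (h : P.FC w s a b) (hx : (w, x) ∈ sumVal H U s a b) {i : ℕ} (hai : a ≤ i) (hib : i < b) :
    (x.take (s i).mdn, x.take (s i).mup) ∈ (s i).val := by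
  obtain ⟨-, -, hlen₁, hlen₂, hpre, -, hmem, hzero, -⟩ := hx
  simp only at hlen₁ hlen₂ hpre hmem hzero
  have mem_val_of_mem_pos : ∀ i, a ≤ i → i < b → x.take (s i).mdn ∈ P.pos w (seg s a i) →
      (x.take (s i).mdn, x.take (s i).mup) ∈ (s i).val := by
    intro i hai hib hpos
    by_cases hiU : i ∈ U
    · exact hmem i hai hib hiU
    · obtain ⟨hK, hbasis⟩ := h.2.1 i hai hib
      have hup := h.mup_le_mup hai (Nat.le_sub_one_of_lt hib) (by lia)
      have hlt := mdn_lt_mup hK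
      rw [(hzero i hai hib hiU).take_eq hlt.le (by lia)]
      exact hv.mem_val_of_mem_pos (ho.zero_pos _ hK _ (hbasis hpos)).1
  refine mem_val_of_mem_pos i hai hib ?_
  induction i, hai using Nat.le_induction with
  | base =>
    rw [← hlen₁, ← List.prefix_iff_eq_take.1 hpre]
    exact mem_pos_seg_self a
  | succ i hai ih =>
    have hib' : i < b := by lia
    rw [← h.2.2 i hai hib]
    exact mem_pos_succ hai (ih hib')
      (mem_pos_of_mem_val (h.2.1 i hai hib').1 (mem_val_of_mem_pos i hai hib' (ih hib')))

theorem Omittory.sumVal_mono {e : ℕ → ℕ → D → D} (ho : P.Omittory e) (hv : P.ValMonotone)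
    {w x : List A} {U V : Finset ℕ} {s : ℕ → WeakCreature A D} {a b : ℕ} (h : P.FC w s a b)
    (hUV : U ⊆ V) (hx : (w, x) ∈ sumVal H U s a b) : (w, x) ∈ sumVal H V s a b := by
  obtain ⟨hw, hx', hlen₁, hlen₂, hpre, hne, -, hzero, hgap⟩ := id hx
  exact ⟨hw, hx', hlen₁, hlen₂, hpre, hne,
    fun i hai hib _ => ho.mem_val_of_mem_sumVal hv h hx hai hib,
    fun i hai hib hi => hzero i hai hib fun hiU => hi (hUV hiU), hgap⟩

theorem sumVal_append_zeros {w x : List A} {U : Finset ℕ} {s : ℕ → WeakCreature A D} {a b c : ℕ}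
    (h : P.FC w s a c) (hab : a < b) (hbc : b ≤ c) (hU : ∀ i ∈ U, i < b)
    (hx : (w, x) ∈ sumVal H U s a b) :
    (w, x ++ H.zeros (s (b - 1)).mup (s (c - 1)).mup) ∈ sumVal H U s a c := by
  obtain ⟨hw, hx, hlen₁, hlen₂, hpre, hne, hmem, hzero, -⟩ := hx
  simp only at hw hx hlen₁ hlen₂ hpre hne hmem hzero
  have hup := h.mup_le_mup (i := b - 1) (j := c - 1) (by lia) (by lia) (by lia)
  have hpre' : x <+: x ++ H.zeros (s (b - 1)).mup (s (c - 1)).mup := List.prefix_append _ _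
  refine ⟨hw, hx.append_zeros hlen₂, hlen₁, ?_, hpre.trans hpre', ?_, ?_, ?_, ?_⟩
  · rw [List.length_append, H.length_zeros, hlen₂]; lia
  · intro heq
    exact hne (hpre.eq_of_length_le (hpre'.length_le.trans_eq (congrArg List.length heq).symm))
  · intro i hai hic hi
    have hupi := h.mup_le_mup hai (Nat.le_sub_one_of_lt (hU i hi)) (by lia)
    have hlt := mdn_lt_mup (h.2.1 i hai hic).1
    simp only
    rw [List.take_append_of_le_length (by lia), List.take_append_of_le_length (by lia)]
    exact hmem i hai (hU i hi) hi
  · intro i hai hic hi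
    obtain hib | hbi := lt_or_ge i b
    · exact (hzero i hai hib hi).of_prefix hpre'
    · refine (Alphabet.zeroOn_append_zeros hlen₂).mono ?_
        (h.mup_le_mup hai (Nat.le_sub_one_of_lt hic) (by lia))
      rw [h.2.2 (b - 1) (by lia) (by lia), Nat.sub_add_cancel (by lia)]
      exact h.mdn_le_mdn (by lia) hbi hic
  · intro i hai hic j hj hj'
    have := h.2.2 i hai hic
    lia

/-! ## Saturation and the AB-type -/

/-- The ends of the intervals `[0, j 0]`, `(j 0, j 1]`, `(j 1, j 2]`, … into which an increasing
sequence `j` cuts `ω`. -/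
def blockStart (j : ℕ → ℕ) : ℕ → ℕ
  | 0 => 0
  | i + 1 => j i + 1

theorem blockStart_le_iff {j : ℕ → ℕ} (hj : StrictMono j) {a b : ℕ} :
    blockStart j a ≤ j b ↔ a ≤ b := by
  cases a with
  | zero => exact iff_of_true (Nat.zero_le _) (Nat.zero_le _)
  | succ a => exact Nat.succ_le_iff.trans (hj.lt_iff_lt.trans Nat.succ_le_iff.symm)

theorem strictMono_blockStart {j : ℕ → ℕ} (hj : StrictMono j) : StrictMono (blockStart j) :=
  strictMono_nat_of_lt_succ fun _ => Nat.lt_succ_of_le ((blockStart_le_iff hj).2 le_rfl)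

theorem exists_blockStart_le_lt {j : ℕ → ℕ} (hj : StrictMono j) (i : ℕ) :
    ∃ a, blockStart j a ≤ i ∧ i < blockStart j (a + 1) := by
  have hbs := strictMono_blockStart hj
  have hunion := iUnion_Ico_map_succ_eq_Ici (fun a => hbs.monotone (Nat.zero_le a))
    hbs.not_bddAbove_range_of_isSuccArchimedean
  exact Set.mem_iUnion.1 (hunion.symm.subset (Set.mem_Ici.2 (Nat.zero_le i)))

/-- The candidate obtained from `⟨r_0, r_1, …⟩` by omitting all creatures except the `r_{j(i)}`: its
`i`-th creature is `r_{j(i)} ⇛ [m₀, m₁)`, where the interval `[m₀, m₁)` is that covered by the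
creatures `r_n` for `j(i-1) < n ≤ j(i)`. -/
noncomputable def omitting (H : Alphabet A) (e : ℕ → ℕ → D → D) (r : ℕ → WeakCreature A D)
    (j : ℕ → ℕ) (i : ℕ) : WeakCreature A D :=
  (r (j i)).extend H e (r (blockStart j i)).mdn (r (j i)).mup

theorem Omittory.omitting_mem_sig {e : ℕ → ℕ → D → D} (ho : P.Omittory e) {w : List A}
    {r : ℕ → WeakCreature A D} (hr : P.Candidate w r) {j : ℕ → ℕ} (hj : StrictMono j) (i : ℕ) :
    omitting H e r j i ∈ P.Sig (seg r (blockStart j i) (blockStart j (i + 1))) :=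
  ho.extend_mem r _ _ (hr.pfc (strictMono_blockStart hj i.lt_succ_self)) (j i)
    ((blockStart_le_iff hj).2 le_rfl) (j i).lt_succ_self

theorem Omittory.pcle_omitting {e : ℕ → ℕ → D → D} (ho : P.Omittory e) {w : List A}
    {r : ℕ → WeakCreature A D} (hr : P.Candidate w r) {j : ℕ → ℕ} (hj : StrictMono j) :
    P.PCLe r (omitting H e r j) :=
  ⟨blockStart j, strictMono_blockStart hj, rfl, ho.omitting_mem_sig hr hj⟩

theorem Omittory.mem_val_of_mem_pos_omitting {e : ℕ → ℕ → D → D} (ho : P.Omittory e)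
    (hn : P.Nice) (hsm : P.Smooth) (hv : P.ValMonotone) {w u : List A}
    {r : ℕ → WeakCreature A D} (hr : P.Candidate w r) {j : ℕ → ℕ} (hj : StrictMono j) {m : ℕ}
    (hu : u ∈ P.pos w (seg (omitting H e r j) 0 m)) {a : ℕ} (ha : a < m) :
    (u.take (r (j a)).mdn, u.take (r (j a)).mup) ∈ (r (j a)).val ∧
      H.ZeroOn u (r (blockStart j a)).mdn (r (j a)).mdn := by
  have hfc : P.FC w (omitting H e r j) 0 m :=
    (hr.pcle hn (ho.pcle_omitting hr hj)).fc (Nat.zero_lt_of_lt ha) (mem_pos_seg_self 0)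
  have hup : (omitting H e r j a).mup = (r (j a)).mup :=
    (hr.linked.mup_of_mem_sig (ho.omitting_mem_sig hr hj a)).trans (hr (j a)).2.1.symm
  have hval := hsm.mem_val_of_mem_pos hv hfc hu a.zero_le ha
  rw [hup] at hval
  obtain ⟨-, -, -, -, -, -, hmem, hzero, -⟩ := hval
  simp only [List.take_take, min_self, min_eq_left (mdn_lt_mup (hr (j a)).1).le] at hmem hzero
  exact ⟨hmem, hzero.of_prefix (List.take_prefix _ u)⟩

open Classical in
/-- The finite set `X ∩ n`. -/
noncomputable def initialPart (X : Set ℕ) (n : ℕ) : Finset ℕ := (Finset.range n).filter (· ∈ X)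

theorem mem_initialPart {X : Set ℕ} {n i : ℕ} : i ∈ initialPart X n ↔ i < n ∧ i ∈ X := by
  simp only [initialPart, Finset.mem_filter, Finset.mem_range]

theorem initialPart_inter_Iio (X : Set ℕ) (n : ℕ) :
    initialPart (X ∩ Set.Iio n) n = initialPart X n := by
  ext i
  grind [mem_initialPart]

theorem initialPart_coe {u : Finset ℕ} {n : ℕ} (hu : ∀ i ∈ u, i < n) :
    initialPart (u : Set ℕ) n = u := by
  ext i
  grind [mem_initialPart]

theorem Omittory.mem_sumVal_of_mem_pos_omitting {e : ℕ → ℕ → D → D} (ho : P.Omittory e)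
    (hn : P.Nice) (hsm : P.Smooth) (hv : P.ValMonotone) {w u : List A}
    {r : ℕ → WeakCreature A D} (hr : P.Candidate w r) {j : ℕ → ℕ} (hj : StrictMono j) {m : ℕ}
    (hm : 0 < m) (hu : u ∈ P.pos w (seg (omitting H e r j) 0 m)) :
    (w, u) ∈ sumVal H (initialPart (Set.range j) (blockStart j m)) r 0 (blockStart j m) := by
  have hbs := strictMono_blockStart hj
  have hpos : u ∈ P.pos w (seg r 0 (blockStart j m)) :=
    mem_pos_of_mem_pos_refinement hbs (ho.omitting_mem_sig hr hj) m.zero_le hu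
  have hlen := hr.length_of_mem_pos hpos
  refine ⟨hr.isSeq, Pos.isSeq hpos hr.isSeq, hr.length_eq, ?_, Pos.prefix hpos, ?_, ?_, ?_, ?_⟩
  · rw [hr.linked.mup_pred (hbs hm)]
    exact hlen
  · rintro (rfl : w = u)
    rw [hr.length_eq] at hlen
    exact (hr.linked.strictMono (hbs hm)).ne hlen
  · intro i _ hi hij
    obtain ⟨a, rfl⟩ := (mem_initialPart.1 hij).2
    have ha : a < m := by rwa [← not_le, blockStart_le_iff hj, not_le] at hi
    exact (ho.mem_val_of_mem_pos_omitting hn hsm hv hr hj hu ha).1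
  · intro i _ hi hij
    obtain ⟨a, hai, hia⟩ := exists_blockStart_le_lt hj i
    have ha : a < m := hbs.lt_iff_lt.1 (hai.trans_lt hi)
    have hne : i ≠ j a := fun h => hij (mem_initialPart.2 ⟨hi, a, h.symm⟩)
    refine (ho.mem_val_of_mem_pos_omitting hn hsm hv hr hj hu ha).2.mono
      (hr.linked.strictMono.monotone hai) ?_
    rw [(hr i).2.1]
    exact hr.linked.strictMono.monotone ((Nat.le_of_lt_succ hia).lt_of_ne hne)
  · intro i _ _ n hin hni
    have := (hr i).2.1
    lia

/-- Clause (α) of the second condition of the AB-type for one creature: `s` has at least half of the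
norm of each block of `t` from which it is built. -/
def KeepsHalf (P : CreatingPair H D) (t : ℕ → WeakCreature A D) (s : WeakCreature A D) : Prop :=
  ∀ a b, s ∈ P.Sig (seg t a b) → minNor t a b / 2 ≤ s.nor

/-- The pure candidates `t' ≥ t` which satisfy clause (α) of the second condition of the AB-type. -/
def HalfRefinement (P : CreatingPair H D) (t t' : ℕ → WeakCreature A D) : Prop :=
  P.PC t' ∧ P.PCLe t t' ∧ ∀ i, P.KeepsHalf t (t' i)

theorem Linked.eq_of_mem_sig {t : ℕ → WeakCreature A D} (ht : P.Linked t) {s : WeakCreature A D}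
    {a b c d : ℕ} (h : s ∈ P.Sig (seg t a b)) (h' : s ∈ P.Sig (seg t c d)) : a = c ∧ b = d :=
  ⟨ht.strictMono.injective ((mdn_of_mem_sig_seg h).symm.trans (mdn_of_mem_sig_seg h')),
    ht.strictMono.injective ((ht.mup_of_mem_sig h).symm.trans (ht.mup_of_mem_sig h'))⟩

theorem Omittory.halfRefinement_omitting {e : ℕ → ℕ → D → D} (ho : P.Omittory e) (hn : P.Nice)
    {w : List A} {r t : ℕ → WeakCreature A D} (ht : P.Candidate w t)
    (hr : ∀ i, r i ∈ P.Sig [t i]) {j : ℕ → ℕ} (hj : StrictMono j)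
    (hnor : ∀ i, (t (j i)).nor / 2 ≤ (r (j i)).nor) :
    P.HalfRefinement t (omitting H e r j) := by
  have hsig : ∀ i, r i ∈ P.Sig (seg t (id i) (id (i + 1))) := fun i => by
    rw [id, id, seg_succ]
    exact hr i
  have htr : P.PCLe t r := ⟨id, strictMono_id, rfl, hsig⟩
  have hrc := ht.pcle hn htr
  have hle := htr.trans (ho.pcle_omitting hrc hj)
  refine ⟨⟨w, ht.pcle hn hle⟩, hle, fun i a b hi => ?_⟩
  have hmem := mem_sig_of_mem_sig_refinement strictMono_id hsig
    (strictMono_blockStart hj i.lt_succ_self).le (ho.omitting_mem_sig hrc hj i)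
  obtain ⟨rfl, rfl⟩ := ht.linked.eq_of_mem_sig hi hmem
  calc minNor t (blockStart j i) (blockStart j (i + 1)) / 2 ≤ (t (j i)).nor / 2 := by
        gcongr
        exact minNor_le t ((blockStart_le_iff hj).2 le_rfl) (j i).lt_succ_self
    _ ≤ (r (j i)).nor := hnor i

/-- Some possibility from `w` in the sum of the `s_i`, `i ∈ X ∩ n`, extends an element of the
target `B`. -/
def Reaches (H : Alphabet A) (B : Set (List A)) (w : List A) (X : Set ℕ) (n : ℕ)
    (s : ℕ → WeakCreature A D) : Prop :=
  0 < n ∧ ∃ x, (w, x) ∈ sumVal H (initialPart X n) s 0 n ∧ ∃ y ∈ B, y <+: x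

theorem Omittory.reaches_mono {e : ℕ → ℕ → D → D} (ho : P.Omittory e) (hv : P.ValMonotone)
    {B : Set (List A)} {w : List A} {X Y : Set ℕ} {m n : ℕ} {s : ℕ → WeakCreature A D}
    (hs : P.FC w s 0 n) (hXY : X ⊆ Y) (hmn : m ≤ n) (h : Reaches H B w X m s) :
    Reaches H B w Y n s := by
  obtain ⟨hm, x, hx, y, hy, hyx⟩ := h
  have hXY' : initialPart X m ⊆ initialPart Y n := fun i hi => by
    rw [mem_initialPart] at hi ⊢
    exact ⟨hi.1.trans_le hmn, hXY hi.2⟩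
  have hx' := sumVal_append_zeros hs hm hmn (fun i hi => (mem_initialPart.1 hi).1) hx
  exact ⟨hm.trans_le hmn, _, ho.sumVal_mono hv hs hXY' hx', y, hy,
    hyx.trans (List.prefix_append _ _)⟩

theorem Reaches.of_val_subset {B : Set (List A)} {w : List A} {X : Set ℕ} {n : ℕ}
    {r s : ℕ → WeakCreature A D} (hdn : ∀ i < n, (r i).mdn = (s i).mdn)
    (hup : ∀ i < n, (r i).mup = (s i).mup) (hval : ∀ i ∈ X, i < n → (r i).val ⊆ (s i).val)
    (h : Reaches H B w X n r) : Reaches H B w X n s := by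
  obtain ⟨hn, x, hx, h⟩ := h
  exact ⟨hn, x, sumVal_subset_sumVal hn (fun i _ => hdn i) (fun i _ => hup i)
    (fun i hi _ => hval i (mem_initialPart.1 hi).2) hx, h⟩

theorem Reaches.congr {B : Set (List A)} {w : List A} {X : Set ℕ} {n : ℕ}
    {r s : ℕ → WeakCreature A D} (hrs : ∀ i < n, (r i).val = (s i).val)
    (h : Reaches H B w X n r) : Reaches H B w X n s :=
  h.of_val_subset (fun i hi => by rw [WeakCreature.mdn, hrs i hi, WeakCreature.mdn])
    (fun i hi => by rw [WeakCreature.mup, hrs i hi, WeakCreature.mup])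
    fun i _ hi => (hrs i hi).subset

theorem WeakHalving.exists_val_subset {half : WeakCreature A D → WeakCreature A D}
    (hh : P.WeakHalving half) (hv : P.ValMonotone) {s t : WeakCreature A D} (ht : t ∈ P.K)
    (hnor : 2 ≤ t.nor) (hs : s ∈ P.Sig [half t]) (hpos : 0 < s.nor) :
    ∃ r ∈ P.Sig [t], t.nor / 2 ≤ r.nor ∧ r.val ⊆ s.val := by
  obtain ⟨r, hr, hrnor, hsub⟩ := hh.2 t ht hnor s hs hpos
  refine ⟨r, hr, hrnor, fun ⟨x, y⟩ hxy => hv.mem_val_of_mem_pos (hsub x ⟨r, hr, y, hxy⟩ ?_)⟩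
  exact mem_pos_of_mem_val (P.sig_subset _ hr) hxy

theorem WeakHalving.exists_reaches {half : WeakCreature A D → WeakCreature A D}
    (hh : P.WeakHalving half) (hn : P.Nice) (hsm : P.Smooth) {e : ℕ → ℕ → D → D}
    (ho : P.Omittory e) (hv : P.ValMonotone) {w : List A} {t : ℕ → WeakCreature A D}
    (hw : P.Candidate w t) (hnor : ∀ i, 2 ≤ (t i).nor)
    {z : (ℕ → WeakCreature A D) → List A}
    (hz : ∀ t', P.PC t' → P.PCLe t t' → ∃ k, z t' ∈ P.pos w (seg t' 0 k)) {X : Set ℕ}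
    (hX : X.Infinite) {s : ℕ → WeakCreature A D} (hs : ∀ i, s i ∈ P.Sig [half (t i)])
    (hspos : ∀ i ∈ X, 0 < (s i).nor) :
    ∃ n, Reaches H (z '' {t' | P.HalfRefinement t t'}) w X n s := by
  have hhalf : ∀ i, half (t i) ∈ P.Sig [t i] := fun i => (hh.1 _ (hw i).1).1
  have hex : ∀ i, ∃ r ∈ P.Sig [t i], i ∈ X → (t i).nor / 2 ≤ r.nor ∧ r.val ⊆ (s i).val := by
    intro i
    by_cases hi : i ∈ X
    · obtain ⟨r, hr, h⟩ := hh.exists_val_subset hv (hw i).1 (hnor i) (hs i) (hspos i hi)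
      exact ⟨r, hr, fun _ => h⟩
    · exact ⟨t i, P.sig_self _ (hw i).1, fun h => absurd h hi⟩
  choose r hr hrX using hex
  have hj : StrictMono (Nat.nth (· ∈ X)) := Nat.nth_strictMono hX
  have hrange : Set.range (Nat.nth (· ∈ X)) = X := Nat.range_nth_of_infinite hX
  have hhr := ho.halfRefinement_omitting hn hw hr hj
    fun i => (hrX _ (Nat.nth_mem_of_infinite hX i)).1
  obtain ⟨k, hk⟩ := hz _ hhr.1 hhr.2.1
  obtain ⟨u, hu⟩ := exists_mem_pos_of_mem_basis (((hw.pcle hn hhr.2.1) k).2.2 hk)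
  have hrw : P.Candidate w r := hw.pcle hn ⟨id, strictMono_id, rfl, fun i => by
    rw [id, id, seg_succ]
    exact hr i⟩
  have hsum := ho.mem_sumVal_of_mem_pos_omitting hn hsm hv hrw hj k.succ_pos
    (mem_pos_succ k.zero_le hk hu)
  rw [hrange] at hsum
  refine ⟨_, Reaches.of_val_subset (fun i _ => ?_) (fun i _ => ?_) (fun i hi _ => (hrX i hi).2)
    ⟨Nat.succ_pos _, u, hsum, _, ⟨_, hhr, rfl⟩, Pos.prefix hu⟩⟩
  · rw [mdn_of_mem_sig (hr i), mdn_of_mem_sig (hs i), mdn_of_mem_sig (hhalf i)]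
  · rw [mup_of_mem_sig (hr i), mup_of_mem_sig (hs i), mup_of_mem_sig (hhalf i)]

/-- The target `B` is reached within `n` by every choice of creatures `s_i ∈ Σ(τ_i)` whose norms are
positive for `i ∈ X`. -/
def ReachesUniformly (P : CreatingPair H D) (B : Set (List A)) (w : List A)
    (τ : ℕ → WeakCreature A D) (X : Set ℕ) (n : ℕ) : Prop :=
  ∀ s : ℕ → WeakCreature A D, (∀ i < n, s i ∈ P.Sig [τ i]) → (∀ i ∈ X, i < n → 0 < (s i).nor) →
    Reaches H B w X n s

section ReachesUniformly

variable {B : Set (List A)} {w : List A} {τ : ℕ → WeakCreature A D} {X Y : Set ℕ} {m n : ℕ}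

theorem reachesUniformly_inter_Iio :
    P.ReachesUniformly B w τ (X ∩ Set.Iio n) n ↔ P.ReachesUniformly B w τ X n := by
  refine forall₂_congr fun s _ => imp_congr ?_ ?_
  · exact ⟨fun h i hi hin => h i ⟨hi, hin⟩ hin, fun h i hi => h i hi.1⟩
  · rw [Reaches, Reaches, initialPart_inter_Iio]

theorem Omittory.reachesUniformly_mono {e : ℕ → ℕ → D → D} (ho : P.Omittory e) (hn : P.Nice)
    (hv : P.ValMonotone) (hτ : P.Candidate w τ) (hXY : X ⊆ Y) (hmn : m ≤ n)
    (h : P.ReachesUniformly B w τ X m) : P.ReachesUniformly B w τ Y n := by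
  intro s hs hpos
  have hreach := h s (fun i hi => hs i (hi.trans_le hmn))
    fun i hi him => hpos i (hXY hi) (him.trans_le hmn)
  have hfc : P.FC w s 0 n := (hτ.fc (hreach.1.trans_le hmn) (mem_pos_seg_self 0)).of_mem_sig hn
    fun i _ => hs i
  exact ho.reaches_mono hv hfc hXY hmn hreach

theorem StronglyFinitary.exists_reachesUniformly (hf : P.StronglyFinitary) {e : ℕ → ℕ → D → D}
    (ho : P.Omittory e) (hn : P.Nice) (hv : P.ValMonotone) (hτ : P.Candidate w τ)
    (h : ∀ s : ℕ → WeakCreature A D, (∀ i, s i ∈ P.Sig [τ i]) → (∀ i ∈ X, 0 < (s i).nor) →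
      ∃ n, Reaches H B w X n s) :
    ∃ n, P.ReachesUniformly B w τ X n := by
  choose F hFfin hFsub hFrep using fun i => hf.2 [τ i]
  have : ∀ i, Finite (F i) := hFfin
  obtain ⟨n, hreach⟩ := exists_uniform_bound (F := fun i => F i)
    (R := fun n s => (∀ i ∈ X, i < n → 0 < (s i).1.nor) → Reaches H B w X n fun i => (s i).1)
    (monotone_nat_of_le_succ fun n s hreach hpos =>
      ho.reaches_mono hv ((hτ.fc n.succ_pos (mem_pos_seg_self 0)).of_mem_sig hn
        fun i _ _ => hFsub i (s i).2) subset_rfl n.le_succ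
        (hreach fun i hi hin => hpos i hi (hin.trans n.lt_succ_self)))
    (fun n s s' hss => propext <| imp_congr
      (by grind) ⟨Reaches.congr fun i hi => by rw [hss i hi],
        Reaches.congr fun i hi => by rw [hss i hi]⟩)
    (fun s => by
      by_cases hpos : ∀ i ∈ X, 0 < (s i).1.nor
      · exact (h _ (fun i => hFsub i (s i).2) hpos).imp fun _ hreach _ => hreach
      · push Not at hpos
        obtain ⟨i, hi, hle⟩ := hpos
        exact ⟨i + 1, fun h => absurd (h i hi i.lt_succ_self) hle.not_gt⟩)
  refine ⟨n, fun s hs hpos => ?_⟩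
  have hrep : ∀ i, ∃ r : F i, i < n → P.Equivalent (s i) r := by
    intro i
    by_cases hi : i < n
    · obtain ⟨r, hr, heq⟩ := hFrep i (s i) (hs i hi)
      exact ⟨⟨r, hr⟩, fun _ => heq⟩
    · obtain ⟨r, hr, -⟩ := hFrep i _ (P.sig_self _ (hτ i).1)
      exact ⟨⟨r, hr⟩, fun h => absurd h hi⟩
  choose r hr using hrep
  refine (hreach r fun i hi hin => ?_).congr fun i hin => (hr i hin).2.2.2.1.symm
  exact (hpos i hi hin).trans_eq (hr i hin).2.2.1

theorem Omittory.eventually_reachesUniformly {e : ℕ → ℕ → D → D} (ho : P.Omittory e)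
    (hn : P.Nice) (hv : P.ValMonotone) (hτ : P.Candidate w τ)
    (h : ∃ n, P.ReachesUniformly B w τ X n) :
    ∀ᶠ n in Filter.atTop, P.ReachesUniformly B w τ X n := by
  obtain ⟨m, hm⟩ := h
  filter_upwards [Filter.eventually_ge_atTop m] with n hmn
  exact ho.reachesUniformly_mono hn hv hτ subset_rfl hmn hm

theorem Saturated.exists_prefix_of_mem_sig_dSum
    {c : (Set ℕ → ℝ≥0) → Finset ℕ → ℕ → List D → D} {N : Set ℕ → ℝ≥0} (hsat : P.Saturated c N)
    {u : Finset ℕ} (hune : u.Nonempty) (hu : 0 < N u) (hτ : P.PFC τ 0 n)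
    (hun : u ⊆ Finset.Ico 0 n) (hpos : ∀ i ∈ u, 0 < (τ i).nor)
    (h : ∀ u' ⊆ u, 0 < N u' → P.ReachesUniformly B w τ u' n) {r : WeakCreature A D}
    (hr : r ∈ P.Sig [dSum H c N u τ 0 n]) (hrpos : 0 < r.nor) :
    ∃ x ∈ P.pos w [r], ∃ y ∈ B, y <+: x := by
  obtain ⟨u', s, -, hu'pos, hu'u, hs, hval, hspos⟩ :=
    (hsat u hune hu τ 0 n hτ hun hpos).2 r hr hrpos
  obtain ⟨-, x, hx, hyx⟩ := h u' hu'u hu'pos s (fun i => hs i i.zero_le) fun i hi _ => hspos i hi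
  rw [initialPart_coe fun i hi => (Finset.mem_Ico.1 (hun (hu'u hi))).2] at hx
  exact ⟨x, mem_pos_of_mem_val (P.sig_subset _ hr) (hval hx), hyx⟩

theorem SaturatedNiceNat.exists_sum_reaching
    {c : (Set ℕ → ℝ≥0) → Finset ℕ → ℕ → List D → D} (hsat : P.SaturatedNiceNat c)
    {e : ℕ → ℕ → D → D} (ho : P.Omittory e) (hn : P.Nice) (hv : P.ValMonotone)
    {V : Set (List A)} (hV : V.Finite) (hVne : V.Nonempty) (hτ : ∀ w ∈ V, P.Candidate w τ)
    (hpos : ∀ i, 0 < (τ i).nor) {B : List A → Set (List A)}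
    (h : ∀ X : Set ℕ, X.Infinite → ∀ w ∈ V, ∃ n, P.ReachesUniformly (B w) w τ X n) (M : ℕ) :
    ∃ n, 0 < n ∧ ∃ s ∈ P.Sig (seg τ 0 n), min (M : ℝ≥0) (minNor τ 0 n) ≤ s.nor ∧
      ∀ w ∈ V, ∀ r ∈ P.Sig [s], 0 < r.nor → ∃ x ∈ P.pos w [r], ∃ y ∈ B w, y <+: x := by
  have heventually : ∀ {X : Set ℕ}, (∀ w ∈ V, ∃ n, P.ReachesUniformly (B w) w τ X n) →
      ∀ᶠ n in Filter.atTop, ∀ w ∈ V, P.ReachesUniformly (B w) w τ X n := fun hX =>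
    (Filter.eventually_all_finite hV).2 fun w hw =>
      ho.eventually_reachesUniformly hn hv (hτ w hw) (hX w hw)
  obtain ⟨N, hN, hNnat, hNpos, u, hu⟩ := exists_nicePreNorm
    (G := fun X => ∀ w ∈ V, ∃ n, P.ReachesUniformly (B w) w τ X n)
    (fun X Y hXY hX w hw => (hX w hw).imp fun _ =>
      ho.reachesUniformly_mono hn hv (hτ w hw) hXY le_rfl)
    (fun X hX => (heventually (h X hX)).exists.imp fun n hn w hw =>
      ⟨n, reachesUniformly_inter_Iio.2 (hn w hw)⟩) M
  have hu0 : 0 < N u := zero_le.trans_lt hu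
  have hune : u.Nonempty := Finset.coe_nonempty.1 (hNpos u hu0).2
  have hreach : ∀ᶠ n in Filter.atTop, ∀ u' ∈ u.powerset, 0 < N u' →
      ∀ w ∈ V, P.ReachesUniformly (B w) w τ u' n := by
    refine (Filter.eventually_all_finset _).2 fun u' _ => ?_
    by_cases hu' : 0 < N u'
    · exact (heventually (hNpos u' hu').1).mono fun _ h _ => h
    · exact .of_forall fun _ h => absurd h hu'
  obtain ⟨n, hn0, hun, hreach⟩ := ((Filter.eventually_gt_atTop 0).and
    (((Filter.eventually_all_finset u).2 fun i _ => Filter.eventually_gt_atTop i).and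
      hreach)).exists
  replace hun : u ⊆ Finset.Ico 0 n := fun i hi => Finset.mem_Ico.2 ⟨i.zero_le, hun i hi⟩
  obtain ⟨w₀, hw₀⟩ := hVne
  have hτn : P.PFC τ 0 n := (hτ w₀ hw₀).pfc hn0
  refine ⟨n, hn0, dSum H c N u τ 0 n,
    (hsat N hN hNnat u hune hu0 τ 0 n hτn hun fun i _ => hpos i).1,
    min_le_min hu.le (le_csInf (hune.to_set.image _) ?_), fun w hw r hr hrpos => ?_⟩
  · rintro _ ⟨i, hi, rfl⟩
    exact minNor_le τ i.zero_le (Finset.mem_Ico.1 (hun hi)).2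
  · exact (hsat N hN hNnat).exists_prefix_of_mem_sig_dSum hune hu0 hτn hun (fun i _ => hpos i)
      (fun u' hu' hu'pos => hreach u' (Finset.mem_powerset.2 hu') hu'pos w hw) hr hrpos

end ReachesUniformly

theorem SaturatedNiceNat.abOne {c : (Set ℕ → ℝ≥0) → Finset ℕ → ℕ → List D → D}
    (hsat : P.SaturatedNiceNat c) (hn : P.Nice) (hsm : P.Smooth) (hf : P.StronglyFinitary)
    {e : ℕ → ℕ → D → D} (ho : P.Omittory e) {half : WeakCreature A D → WeakCreature A D}
    (hh : P.WeakHalving half) (hv : P.ValMonotone) : P.ABOne := by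
  intro w t hw N₀ hnor z hz
  let T : ℕ → WeakCreature A D := fun i => t (N₀ + i)
  have hK : ∀ i, T i ∈ P.K := fun i => (hw (N₀ + i)).1
  have hT : ∀ v ∈ P.pos w (seg t 0 N₀), P.Candidate v T := fun v hv => hw.tail hn hv
  have hTnor : ∀ i, 2 < (T i).nor := fun i => hnor _ (Nat.le_add_right _ _)
  have hhalf : ∀ i, half (T i) ∈ P.Sig [T i] ∧ (T i).nor / 2 ≤ (half (T i)).nor :=
    fun i => hh.1 _ (hK i)
  have hsig : ∀ i, half (T i) ∈ P.Sig (seg T (id i) (id (i + 1))) := fun i => by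
    rw [id, id, seg_succ]
    exact (hhalf i).1
  have hτ : ∀ v ∈ P.pos w (seg t 0 N₀), P.Candidate v fun i => half (T i) :=
    fun v hv => (hT v hv).pcle hn ⟨id, strictMono_id, rfl, hsig⟩
  obtain ⟨M, hM⟩ := exists_nat_gt (T 0).nor
  obtain ⟨n, hn0, s, hs, hsnor, hreach⟩ := hsat.exists_sum_reaching ho hn hv
    (hf.1.finite_pos hw N₀) (hw.pos_nonempty N₀) hτ
    (fun i => (half_pos (two_pos.trans (hTnor i))).trans_le (hhalf i).2)
    (B := fun v => z v '' {t' | P.HalfRefinement T t'})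
    (fun X hX v hvw => hf.exists_reachesUniformly ho hn hv (hτ v hvw) fun s hs hspos =>
      hh.exists_reaches hn hsm ho hv (hT v hvw) (fun i => (hTnor i).le)
        (fun t' h1 h2 => (hz.2 v hvw t' h1 h2).imp fun _ h => h.1) hX hs hspos) M
  have hsT := mem_sig_of_mem_sig_refinement strictMono_id hsig n.zero_le hs
  rw [id, id, seg_shift, add_zero] at hsT
  have hmin : minNor t N₀ (N₀ + n) / 2 ≤ s.nor := by
    rw [← add_zero N₀, add_assoc, zero_add, ← minNor_shift]
    refine (le_min ?_ ?_).trans hsnor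
    · calc minNor T 0 n / 2 ≤ minNor T 0 n := half_le_self zero_le
        _ ≤ (T 0).nor := minNor_le T le_rfl hn0
        _ ≤ M := hM.le
    · exact minNor_div_two_le hn0 fun i => (hhalf i).2
  refine ⟨N₀ + n, by lia, s, hsT, hmin, fun v hvw r hr hrpos => ?_⟩
  obtain ⟨x, hx, _, ⟨t', ⟨hpc, hle, hhr⟩, rfl⟩, hzx⟩ := hreach v hvw r hr hrpos
  refine ⟨t', hpc, hle, fun i k l hi => ?_, x, hx, hzx⟩
  have := hhr i k (k + l + 1)
  rw [seg_shift, minNor_shift, ← add_assoc, ← add_assoc] at this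
  exact this hi

/-! ## Pure decisions and fusion -/

/-- The norm requirement on the conditions of `Q*_{s∞}(K, Σ)`. As `i ≤ m_dn(t_i)` for linked
sequences, the bound `max {i, m_dn(t_i)}` of the definition is `m_dn(t_i)`. -/
def Normed (t : ℕ → WeakCreature A D) : Prop := ∀ i, ((t i).mdn : ℝ≥0) < (t i).nor

theorem Normed.shift {t : ℕ → WeakCreature A D} (h : Normed t) (n : ℕ) :
    Normed fun i => t (n + i) :=
  fun i => h (n + i)

theorem Normed.mdn_lt_minNor {t : ℕ → WeakCreature A D} (h : Normed t) (ht : P.Linked t)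
    {a b : ℕ} (hab : a < b) : ((t a).mdn : ℝ≥0) < minNor t a b := by
  obtain ⟨i, hai, -, hmin⟩ := exists_minNor_eq t hab
  rw [hmin]
  refine lt_of_le_of_lt ?_ (h i)
  exact_mod_cast ht.strictMono.monotone hai

theorem QStarSInf.normed (p : P.QStarSInf) : Normed p.t := fun i =>
  lt_of_le_of_lt (Nat.cast_le.2 (le_max_right _ _)) (p.norm i)

/-- The condition of `Q*_{s∞}(K, Σ)` given by a root and a sequence with large norms. -/
def Candidate.condition {w : List A} {t : ℕ → WeakCreature A D} (h : P.Candidate w t)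
    (ht : Normed t) : P.QStarSInf where
  w := w
  t := t
  candidate := h
  norm i := by rw [max_eq_right h.linked.strictMono.le_apply]; exact ht i

theorem pcle_tail_of_refinement {s t : ℕ → WeakCreature A D} {k : ℕ → ℕ} (hk : StrictMono k)
    (hs : ∀ i, s i ∈ P.Sig (seg t (k i) (k (i + 1)))) (c : ℕ) :
    P.PCLe (fun i => t (k c + i)) fun i => s (c + i) := by
  have hle : ∀ i, k c ≤ k (c + i) := fun i => hk.monotone (Nat.le_add_right c i)
  refine ⟨fun i => k (c + i) - k c, strictMono_nat_of_lt_succ fun i => ?_, Nat.sub_self _,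
    fun i => ?_⟩
  · exact Nat.sub_lt_sub_right (hle i) (hk (Nat.lt_succ_self (c + i)))
  · rw [seg_shift, Nat.add_sub_cancel' (hle i), Nat.add_sub_cancel' (hle (i + 1))]
    exact hs (c + i)

theorem QStarSInf.le_iff {p q : P.QStarSInf} :
    p ≤ q ↔ ∃ n, q.w ∈ P.pos p.w (seg p.t 0 n) ∧ P.PCLe (fun i => p.t (n + i)) q.t := by
  constructor
  · rintro ⟨k, hk, hw, hs⟩
    have htail := pcle_tail_of_refinement hk hs 0
    simp only [zero_add] at htail
    exact ⟨k 0, hw, htail⟩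
  · rintro ⟨n, hw, k, hk, hk0, hs⟩
    refine ⟨fun i => n + k i, hk.const_add n, by simpa only [hk0, add_zero] using hw, fun i => ?_⟩
    rw [← seg_shift]
    exact hs i

theorem QStarSInf.le_of_pcle {p q : P.QStarSInf} (hw : q.w = p.w) (h : P.PCLe p.t q.t) :
    p ≤ q := by
  refine le_iff.2 ⟨0, hw ▸ mem_pos_seg_self 0, ?_⟩
  simp only [zero_add]
  exact h

theorem QStarSInf.le_condition_tail (hn : P.Nice) {p : P.QStarSInf} {w : List A} {n : ℕ}
    (hw : w ∈ P.pos p.w (seg p.t 0 n)) :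
    p ≤ (p.candidate.tail hn hw).condition (p.normed.shift n) :=
  le_iff.2 ⟨n, hw, PCLe.refl fun i => (p.candidate (n + i)).1⟩

theorem Smooth.mem_pos_of_prefix (hs : P.Smooth) {w u x : List A} {t : ℕ → WeakCreature A D}
    (hw : P.Candidate w t) {k n : ℕ} (hu : u ∈ P.pos w (seg t 0 k))
    (hx : x ∈ P.pos w (seg t 0 n)) (hux : u <+: x) : k ≤ n ∧ x ∈ P.pos u (seg t k n) := by
  have hlu := hw.length_of_mem_pos hu
  have hlx := hw.length_of_mem_pos hx
  have hkn : k ≤ n := hw.linked.strictMono.le_iff_le.1 (by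
    simp only [← hlu, ← hlx]
    exact hux.length_le)
  refine ⟨hkn, ?_⟩
  obtain rfl | hlt := hkn.eq_or_lt
  · rw [hux.eq_of_length (hlu.trans hlx.symm)]
    exact mem_pos_seg_self k
  · have hpos := (hs w t 0 n (hw.fc (k.zero_le.trans_lt hlt) (mem_pos_seg_self 0)) k k.zero_le hlt
      x hx).2
    rwa [← hlu, ← List.prefix_iff_eq_take.1 hux] at hpos

end CreatingPair

/-- Some `k < b` is put into `τ` as the value at `n` by a condition below `q`, so that `q` forces
`τ(n) = k`. -/
def BaireName.DecidesBelow {Q : Type*} [Preorder Q] (τ : BaireName Q) (q : Q) (n b : ℕ) : Prop :=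
  ∃ k < b, ∃ r, τ.mem n k r ∧ r ≤ q

namespace BaireName

variable {Q : Type*} [Preorder Q] {τ : BaireName Q} {q : Q} {n b : ℕ}

theorem DecidesBelow.mono {q' : Q} (h : τ.DecidesBelow q n b) (hq : q ≤ q') :
    τ.DecidesBelow q' n b := by
  obtain ⟨k, hk, r, hr, hrq⟩ := h
  exact ⟨k, hk, r, hr, hrq.trans hq⟩

theorem DecidesBelow.mono_bound {b' : ℕ} (h : τ.DecidesBelow q n b) (hb : b ≤ b') :
    τ.DecidesBelow q n b' := by
  obtain ⟨k, hk, hr⟩ := h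
  exact ⟨k, hk.trans_le hb, hr⟩

theorem exists_decidesBelow (τ : BaireName Q) (n : ℕ) (p : Q) :
    ∃ q, p ≤ q ∧ ∃ b, τ.DecidesBelow q n b := by
  obtain ⟨q, hq, k, hr⟩ := τ.total n p
  exact ⟨q, hq, k + 1, k, k.lt_succ_self, hr⟩

end BaireName

namespace CreatingPair

variable {P : CreatingPair H D} {τ : BaireName P.QStarSInf}

/-- The pair `(v, t)` is a condition of `Q*_{s∞}(K, Σ)` which decides the value of `τ` at `m` to be
below `b`. -/
def DecidesBelow (τ : BaireName P.QStarSInf) (m b : ℕ) (v : List A) (t : ℕ → WeakCreature A D) :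
    Prop :=
  ∃ (h : P.Candidate v t) (ht : Normed t), τ.DecidesBelow (h.condition ht) m b

/-- The pair `(v, t)` is a condition of `Q*_{s∞}(K, Σ)` which decides the value of `τ` at `m`. -/
def Decides (τ : BaireName P.QStarSInf) (m : ℕ) (v : List A) (t : ℕ → WeakCreature A D) : Prop :=
  ∃ b, P.DecidesBelow τ m b v t

theorem Decides.pcle (hn : P.Nice) {m : ℕ} {v : List A} {s t : ℕ → WeakCreature A D}
    (h : P.Decides τ m v t) (hts : P.PCLe t s) (hs : Normed s) : P.Decides τ m v s := by
  obtain ⟨b, hv, ht, hb⟩ := h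
  exact ⟨b, hv.pcle hn hts, hs, hb.mono (QStarSInf.le_of_pcle rfl hts)⟩

theorem Smooth.decidesBelow_of_prefix (hs : P.Smooth) {w u : List A} {t : ℕ → WeakCreature A D}
    (hw : P.Candidate w t) (ht : Normed t) {m b k : ℕ} (hu : u ∈ P.pos w (seg t 0 k))
    (hd : P.DecidesBelow τ m b u fun i => t (k + i)) {q : P.QStarSInf}
    (hq : hw.condition ht ≤ q) (huq : u <+: q.w) : τ.DecidesBelow q m b := by
  obtain ⟨n, hqn, hqt⟩ := QStarSInf.le_iff.1 hq
  obtain ⟨hkn, hpos⟩ := hs.mem_pos_of_prefix hw hu hqn huq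
  obtain ⟨d, rfl⟩ := Nat.exists_eq_add_of_le hkn
  obtain ⟨_, _, hb⟩ := hd
  refine hb.mono (QStarSInf.le_iff.2 ⟨d, ?_, ?_⟩)
  · exact (seg_shift t k 0 d).symm ▸ hpos
  · simpa only [Candidate.condition, add_assoc] using hqt

/-- If some pure extension of `(v, t)` decides the value of `τ` at `m`, then so does `(v, t)`
itself. -/
def PureDecision (τ : BaireName P.QStarSInf) (t : ℕ → WeakCreature A D) (v : List A) (m : ℕ) :
    Prop :=
  ∀ s, P.PCLe t s → P.Decides τ m v s → P.Decides τ m v t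

theorem PureDecision.pcle (hn : P.Nice) {s t : ℕ → WeakCreature A D} {v : List A} {m : ℕ}
    (h : P.PureDecision τ t v m) (hts : P.PCLe t s) (hs : Normed s) : P.PureDecision τ s v m :=
  fun r hsr hr => (h r (hts.trans hsr) hr).pcle hn hts hs

theorem exists_pureDecision_of_finite (hn : P.Nice) {t : ℕ → WeakCreature A D} (ht : P.Linked t)
    (htn : Normed t) {E : Set (List A × ℕ)} (hE : E.Finite) :
    ∃ s, P.PCLe t s ∧ Normed s ∧ ∀ x ∈ E, P.PureDecision τ s x.1 x.2 := by
  induction E, hE using Set.Finite.induction_on with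
  | empty => exact ⟨t, PCLe.refl fun i => (ht i).1, htn, fun x hx => hx.elim⟩
  | @insert x E _ _ ih =>
    obtain ⟨s, hts, hs, hE⟩ := ih
    by_cases hex : ∃ r, P.PCLe s r ∧ P.Decides τ x.2 x.1 r
    · obtain ⟨r, hsr, hr⟩ := hex
      obtain ⟨_, _, hrn, _⟩ := id hr
      refine ⟨r, hts.trans hsr, hrn, ?_⟩
      rintro y (rfl | hy)
      · exact fun _ _ _ => hr
      · exact (hE y hy).pcle hn hsr hrn
    · refine ⟨s, hts, hs, ?_⟩
      rintro y (rfl | hy)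
      · exact fun r hsr hr => absurd ⟨r, hsr, hr⟩ hex
      · exact hE y hy

theorem exists_pureDecision (hn : P.Nice) (hf : P.Finitary) (τ : BaireName P.QStarSInf)
    {t : ℕ → WeakCreature A D} (ht : P.Linked t) (htn : Normed t) :
    ∃ s, P.PCLe t s ∧ Normed s ∧ ∀ v, ∀ m ≤ (s 0).mdn, P.PureDecision τ s v m := by
  obtain ⟨s, hts, hs, hE⟩ := exists_pureDecision_of_finite (τ := τ) hn ht htn
    ((H.finite_isSeq hf.1 (t 0).mdn).prod (Set.finite_Iic (t 0).mdn))
  refine ⟨s, hts, hs, fun v m hm r hsr hr => ?_⟩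
  obtain ⟨_, hv, -⟩ := id hr
  exact hE (v, m) ⟨⟨hv.isSeq, hv.length_eq.trans (hsr.mdn_zero.trans hts.mdn_zero)⟩,
    hm.trans_eq hts.mdn_zero⟩ r hsr hr

theorem exists_pcle_tail_of_forall_pcle_tail {X : ℕ → ℕ → WeakCreature A D}
    (hX : ∀ n, P.Linked (X n)) (h : ∀ n, P.PCLe (fun i => X n (1 + i)) (X (n + 1))) (n i : ℕ) :
    ∃ d, P.PCLe (fun j => X n (d + j)) (X (n + i)) := by
  induction i with
  | zero => exact ⟨0, by
    simpa only [zero_add, add_zero] using PCLe.refl fun j => (hX n j).1⟩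
  | succ i ih =>
    obtain ⟨d, k, hk, _, hs⟩ := ih
    have htail := pcle_tail_of_refinement hk hs 1
    simp only [← add_assoc] at htail
    exact ⟨d + k 1, htail.trans (h (n + i))⟩

theorem pcle_diagonal {X : ℕ → ℕ → WeakCreature A D} (hX : ∀ n, P.Linked (X n))
    (h : ∀ n, P.PCLe (fun i => X n (1 + i)) (X (n + 1))) (n : ℕ) :
    P.PCLe (X n) fun i => X (n + i) 0 := by
  have hlinked : P.Linked fun i => X (n + i) 0 := fun i =>
    ⟨(hX (n + i) 0).1, (hX (n + i) 0).2.trans (h (n + i)).mdn_zero.symm⟩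
  refine PCLe.of_forall_mem_sig (hX n) hlinked rfl fun i => ?_
  obtain ⟨d, k, _, _, hs⟩ := exists_pcle_tail_of_forall_pcle_tail hX h n i
  exact ⟨_, _, by simpa only [seg_shift] using hs 0⟩

theorem exists_fusion (hn : P.Nice) (hf : P.Finitary) (τ : BaireName P.QStarSInf)
    {t : ℕ → WeakCreature A D} (ht : P.Linked t) (htn : Normed t) :
    ∃ s, P.PCLe t s ∧ Normed s ∧
      ∀ n v, ∀ m ≤ (s n).mdn, P.PureDecision τ (fun i => s (n + i)) v m := by
  have : Nonempty (WeakCreature A D) := ⟨t 0⟩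
  choose! f hle hfn hpure using fun (r : ℕ → WeakCreature A D) (hr : P.Linked r ∧ Normed r) =>
    exists_pureDecision hn hf τ hr.1 hr.2
  let X : ℕ → ℕ → WeakCreature A D := fun n => Nat.rec t (fun _ r i => f r (1 + i)) n
  have hX : ∀ n, P.Linked (X n) ∧ Normed (X n) := by
    intro n
    induction n with
    | zero => exact ⟨ht, htn⟩
    | succ n ih => exact ⟨((hle _ ih).linked ih.1).shift 1, (hfn _ ih).shift 1⟩
  have hdiag := pcle_diagonal (X := fun n => f (X n)) (fun n => (hle _ (hX n)).linked (hX n).1)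
    fun n => hle _ (hX (n + 1))
  have hs : Normed fun n => f (X n) 0 := fun n => hfn _ (hX n) 0
  refine ⟨fun n => f (X n) 0, ?_, hs,
    fun n v m hm => (hpure _ (hX n) v m hm).pcle hn (hdiag n) (hs.shift n)⟩
  have h0 := (hle _ (hX 0)).trans (hdiag 0)
  simp only [zero_add] at h0
  exact h0

theorem pos_seg_congr_of_equivalent {w : List A} {s t : ℕ → WeakCreature A D} {a b : ℕ}
    (h : ∀ i, a ≤ i → i < b → P.Equivalent (s i) (t i)) :
    P.pos w (seg s a b) = P.pos w (seg t a b) :=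
  (pos_seg_subset_of_mem_sig fun i hai hib =>
      (h i hai hib).symm.mem_sig (P.sig_self _ (h i hai hib).2.1)).antisymm
    (pos_seg_subset_of_mem_sig fun i hai hib =>
      (h i hai hib).mem_sig (P.sig_self _ (h i hai hib).1))

theorem sInf_nonempty_congr {α : Type*} {V V' : ℕ → Set α} (hV : ∃ j, (V j).Nonempty)
    (h : ∀ j ≤ sInf {j | (V j).Nonempty}, V' j = V j) :
    sInf {j | (V' j).Nonempty} = sInf {j | (V j).Nonempty} := by
  have hmem : V (sInf {j | (V j).Nonempty}) |>.Nonempty := Nat.sInf_mem hV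
  have hmem' : V' (sInf {j | (V j).Nonempty}) |>.Nonempty := by rwa [h _ le_rfl]
  have hle : sInf {j | (V' j).Nonempty} ≤ sInf {j | (V j).Nonempty} := Nat.sInf_le hmem'
  have hmin : (V' (sInf {j | (V' j).Nonempty})).Nonempty :=
    Nat.sInf_mem (s := {j | (V' j).Nonempty}) ⟨_, hmem'⟩
  rw [h _ hle] at hmin
  exact hle.antisymm (Nat.sInf_le hmin)

theorem exists_isDecisionFunction {w : List A} {t : ℕ → WeakCreature A D} {N₀ : ℕ}
    {V : List A → (ℕ → WeakCreature A D) → ℕ → Set (List A)}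
    (hpos : ∀ v t' j, V v t' j ⊆ P.pos v (seg t' 0 j))
    (hcongr : ∀ v t' t'' j, (∀ i < j, P.Equivalent (t'' i) (t' i)) → V v t'' j = V v t' j)
    (hne : ∀ v ∈ P.pos w (seg t 0 N₀), ∀ t', P.PC t' → P.PCLe (fun i => t (N₀ + i)) t' →
      ∃ j, (V v t' j).Nonempty) :
    ∃ z, P.IsDecisionFunction w t N₀ z ∧ ∀ v ∈ P.pos w (seg t 0 N₀), ∀ t', P.PC t' →
      P.PCLe (fun i => t (N₀ + i)) t' → ∃ j, z v t' ∈ V v t' j := by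
  classical
  let J : List A → (ℕ → WeakCreature A D) → ℕ := fun v t' => sInf {j | (V v t' j).Nonempty}
  let z : List A → (ℕ → WeakCreature A D) → List A := fun v t' =>
    if P.PCLe (fun i => t (N₀ + i)) t' then Classical.epsilon (· ∈ V v t' (J v t')) else v
  have hz : ∀ v ∈ P.pos w (seg t 0 N₀), ∀ t', P.PC t' → P.PCLe (fun i => t (N₀ + i)) t' →
      z v t' ∈ V v t' (J v t') := by
    intro v hv t' hpc hle
    simp only [z, if_pos hle]
    exact Classical.epsilon_spec (p := (· ∈ V v t' (J v t'))) (Nat.sInf_mem (hne v hv t' hpc hle))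
  refine ⟨z, ⟨fun v hv t' hpc => ?_, fun v hv t' hpc hle =>
    ⟨J v t', hpos _ _ _ (hz v hv t' hpc hle), fun t'' _ hle'' heq => ?_⟩⟩,
    fun v hv t' hpc hle => ⟨_, hz v hv t' hpc hle⟩⟩
  · by_cases hle : P.PCLe (fun i => t (N₀ + i)) t'
    · have hzpos := hpos _ _ _ (hz v hv t' hpc hle)
      obtain ⟨k, hk, hk0, hs⟩ := hle
      have hzpos' := mem_pos_of_mem_pos_refinement hk hs (Nat.zero_le _) hzpos
      rw [seg_shift, hk0] at hzpos'
      exact ⟨_, Nat.le_add_right _ _, mem_pos_append N₀.zero_le (Nat.le_add_right _ _) hv hzpos'⟩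
    · exact ⟨N₀, le_rfl, by simpa only [z, if_neg hle] using hv⟩
  · have hJ : J v t'' = J v t' := sInf_nonempty_congr (hne v hv t' hpc hle) fun j hj =>
      hcongr v t' t'' j fun i hi => heq i (hi.trans_le hj)
    simp only [z, if_pos hle, if_pos hle'', hJ, hcongr v t' t'' _ heq]

/-! ## Deciding blocks -/

theorem exists_refinement_of_forall_exists {t : ℕ → WeakCreature A D}
    {R : ℕ → ℕ → WeakCreature A D → Prop} (h : ∀ a, ∃ b, ∃ s ∈ P.Sig (seg t a b), R a b s) :
    ∃ (k : ℕ → ℕ) (s : ℕ → WeakCreature A D), StrictMono k ∧ k 0 = 0 ∧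
      ∀ i, s i ∈ P.Sig (seg t (k i) (k (i + 1))) ∧ R (k i) (k (i + 1)) (s i) := by
  choose b s hs hR using h
  let k : ℕ → ℕ := fun i => b^[i] 0
  have hk : ∀ i, k (i + 1) = b (k i) := fun i => Function.iterate_succ_apply' _ _ _
  refine ⟨k, fun i => s (k i), strictMono_nat_of_lt_succ fun i => ?_, rfl, fun i => ?_⟩ <;> rw [hk]
  · exact lt_of_mem_sig_seg (hs _)
  · exact ⟨hs _, hR _⟩

theorem Growing.exists_normed (hg : P.Growing) {w : List A} {t : ℕ → WeakCreature A D}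
    (hw : P.Candidate w t) (h : ∀ a n : ℕ, ∃ i, a ≤ i ∧ (n : ℝ≥0) < (t i).nor) :
    ∃ s, P.PCLe t s ∧ Normed s := by
  have hblock : ∀ a, ∃ b, ∃ s ∈ P.Sig (seg t a b), ((t a).mdn : ℝ≥0) < s.nor := fun a => by
    obtain ⟨i, hai, hi⟩ := h a (t a).mdn
    obtain ⟨s, hs, hsn⟩ := hg t a (i + 1) (hw.pfc (Nat.lt_succ_of_le hai))
    exact ⟨i + 1, s, hs, hi.trans_le (hsn i hai i.lt_succ_self)⟩
  obtain ⟨k, s, hk, hk0, hs⟩ := exists_refinement_of_forall_exists hblock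
  exact ⟨s, ⟨k, hk, hk0, fun i => (hs i).1⟩,
    fun i => (mdn_of_mem_sig_seg (hs i).1).symm ▸ (hs i).2⟩

theorem HalfRefinement.mdn_div_two_le {t t' : ℕ → WeakCreature A D} (h : P.HalfRefinement t t')
    (ht : P.Linked t) (htn : Normed t) (i : ℕ) : ((t' i).mdn : ℝ≥0) / 2 ≤ (t' i).nor := by
  obtain ⟨-, ⟨k, hk, -, hs⟩, hhalf⟩ := h
  refine le_trans ?_ (hhalf i _ _ (hs i))
  rw [mdn_of_mem_sig_seg (hs i)]
  gcongr
  exact (htn.mdn_lt_minNor ht (hk i.lt_succ_self)).le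

theorem Equivalent.keepsHalf_iff {s s' : WeakCreature A D} (h : P.Equivalent s s')
    (t : ℕ → WeakCreature A D) : P.KeepsHalf t s ↔ P.KeepsHalf t s' :=
  forall₂_congr fun _ _ => by rw [h.2.2.1, Iff.intro h.mem_sig h.symm.mem_sig]

/-- A condition `(w, t)` of `Q*_{s∞}(K, Σ)` as it comes out of the fusion argument: every tail of
`t` decides those values of `τ` with index below its first `m_dn` which some pure extension
decides. -/
structure Fused (τ : BaireName P.QStarSInf) (w : List A) (t : ℕ → WeakCreature A D) : Prop where
  candidate : P.Candidate w t
  normed : Normed t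
  pureDecision : ∀ n v, ∀ m ≤ (t n).mdn, P.PureDecision τ (fun i => t (n + i)) v m

theorem Fused.exists_decides (hn : P.Nice) (hg : P.Growing) {w v : List A}
    {t t' : ℕ → WeakCreature A D} (h : P.Fused τ w t) {m : ℕ} (hv : v ∈ P.pos w (seg t 0 m))
    (ht' : P.HalfRefinement (fun i => t (m + i)) t') :
    ∃ j, ∃ u ∈ P.pos v (seg t' 0 j), ∃ n, u ∈ P.pos w (seg t 0 n) ∧
      P.Decides τ m u fun i => t (n + i) := by
  have hvt := h.candidate.tail hn hv
  have hvt' := hvt.pcle hn ht'.2.1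
  obtain ⟨s, hs, hsn⟩ := hg.exists_normed hvt' fun a n => by
    refine ⟨a + (2 * n + 1), Nat.le_add_right _ _,
      lt_of_lt_of_le ?_ (ht'.mdn_div_two_le hvt.linked (h.normed.shift m) _)⟩
    have hmdn := hvt'.linked.strictMono.le_apply (x := a + (2 * n + 1))
    rw [lt_div_iff₀ two_pos]
    exact_mod_cast (by lia : n * 2 < (t' (a + (2 * n + 1))).mdn)
  obtain ⟨q, hq, b, hb⟩ := τ.exists_decidesBelow m ((hvt'.pcle hn hs).condition hsn)
  obtain ⟨a, hqs, -⟩ := QStarSInf.le_iff.1 hq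
  have hle : h.candidate.condition h.normed ≤ (hvt'.pcle hn hs).condition hsn :=
    QStarSInf.le_iff.2 ⟨m, hv, ht'.2.1.trans hs⟩
  obtain ⟨n, hqn, hqt⟩ := QStarSInf.le_iff.1 (hle.trans hq)
  obtain ⟨k, hk, hk0, hs⟩ := hs
  have hqt' := mem_pos_of_mem_pos_refinement (w := v) hk hs a.zero_le hqs
  rw [hk0] at hqt'
  refine ⟨k a, q.w, hqt', n, hqn,
    h.pureDecision n q.w m ?_ q.t hqt ⟨b, q.candidate, q.normed, hb⟩⟩
  calc m ≤ (t m).mdn := h.candidate.linked.strictMono.le_apply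
    _ = v.length := (h.candidate.length_of_mem_pos hv).symm
    _ ≤ q.w.length := (Pos.prefix hqt').length_le
    _ = (t n).mdn := h.candidate.length_of_mem_pos hqn

theorem Fused.exists_isDecisionFunction (hn : P.Nice) (hg : P.Growing) {w : List A}
    {t : ℕ → WeakCreature A D} (h : P.Fused τ w t) (m : ℕ) :
    ∃ z, P.IsDecisionFunction w t m z ∧ ∀ v ∈ P.pos w (seg t 0 m), ∀ t',
      P.HalfRefinement (fun i => t (m + i)) t' →
        ∃ n, z v t' ∈ P.pos w (seg t 0 n) ∧ P.Decides τ m (z v t') fun i => t (n + i) := by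
  let V : List A → (ℕ → WeakCreature A D) → ℕ → Set (List A) := fun v t' j =>
    {u ∈ P.pos v (seg t' 0 j) | (∃ i < j, ¬ P.KeepsHalf (fun i => t (m + i)) (t' i)) ∨
      ∃ n, u ∈ P.pos w (seg t 0 n) ∧ P.Decides τ m u fun i => t (n + i)}
  obtain ⟨z, hz, hzV⟩ := CreatingPair.exists_isDecisionFunction (w := w) (t := t) (N₀ := m) (V := V)
    (fun _ _ _ => Set.sep_subset _ _)
    (fun v t' t'' j heq => by
      have hpos := pos_seg_congr_of_equivalent (w := v) (a := 0) fun i _ hij => heq i hij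
      have hkeep : (∃ i < j, ¬ P.KeepsHalf (fun i => t (m + i)) (t'' i)) ↔
          ∃ i < j, ¬ P.KeepsHalf (fun i => t (m + i)) (t' i) :=
        exists_congr fun i => and_congr_right fun hij => not_congr ((heq i hij).keepsHalf_iff _)
      simp only [V, hpos, hkeep])
    (fun v hv t' hpc hle => by
      by_cases hhalf : ∀ i, P.KeepsHalf (fun i => t (m + i)) (t' i)
      · obtain ⟨j, u, hu, hd⟩ := h.exists_decides hn hg hv ⟨hpc, hle, hhalf⟩
        exact ⟨j, u, hu, Or.inr hd⟩
      · obtain ⟨i, hi⟩ := not_forall.1 hhalf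
        obtain ⟨u, hu⟩ := ((h.candidate.tail hn hv).pcle hn hle).pos_nonempty (i + 1)
        exact ⟨i + 1, u, hu, Or.inl ⟨i, i.lt_succ_self, hi⟩⟩)
  refine ⟨z, hz, fun v hv t' ht' => ?_⟩
  obtain ⟨j, -, ⟨i, -, hi⟩ | hd⟩ := hzV v hv t' ht'.1 ht'.2.1
  · exact absurd (ht'.2.2 i) hi
  · exact hd

theorem Finitary.exists_decidesBelow (hf : P.Finitary) {w : List A} {t : ℕ → WeakCreature A D}
    (hw : P.Candidate w t) (τ : BaireName P.QStarSInf) (m n : ℕ) :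
    ∃ b, ∀ x ∈ P.pos w (seg t 0 n), P.Decides τ m x (fun i => t (n + i)) →
      P.DecidesBelow τ m b x fun i => t (n + i) := by
  have hfin : {x ∈ P.pos w (seg t 0 n) | P.Decides τ m x fun i => t (n + i)}.Finite :=
    (hf.finite_pos hw n).subset (Set.sep_subset _ _)
  have hmono : ∀ x, Monotone fun b => P.DecidesBelow τ m b x fun i => t (n + i) :=
    fun x b b' hbb' ⟨hx, ht, hb⟩ => ⟨hx, ht, hb.mono_bound hbb'⟩
  have hev : ∀ᶠ b in Filter.atTop, ∀ x ∈ {x ∈ P.pos w (seg t 0 n) |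
      P.Decides τ m x fun i => t (n + i)}, P.DecidesBelow τ m b x fun i => t (n + i) :=
    (Filter.eventually_all_finite hfin).2 fun x ⟨_, b, hb⟩ =>
      Filter.eventually_atTop.2 ⟨b, fun b' hbb' => hmono x hbb' hb⟩
  obtain ⟨b, hb⟩ := hev.exists
  exact ⟨b, fun x hx hd => hb x ⟨hx, hd⟩⟩

/-- A creature `s ∈ Σ(t_a, …, t_{n-1})` which determines `τ(m) < b` up to the choice of a
possibility: as long as the norm stays positive, a possibility remains which together with
`t_n, t_{n+1}, …` decides this. -/
structure DecidingBlock (τ : BaireName P.QStarSInf) (w : List A) (t : ℕ → WeakCreature A D)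
    (m b a n : ℕ) (s : WeakCreature A D) : Prop where
  mem_sig : s ∈ P.Sig (seg t a n)
  exists_decidesBelow : ∀ v ∈ P.pos w (seg t 0 a), ∀ r ∈ P.Sig [s], 0 < r.nor →
    ∃ x ∈ P.pos v [r], P.DecidesBelow τ m b x fun i => t (n + i)

theorem mem_pos_seg_of_mem_sig_block {w v x : List A} {t : ℕ → WeakCreature A D} {a n : ℕ}
    {r s : WeakCreature A D} (hs : s ∈ P.Sig (seg t a n)) (hr : r ∈ P.Sig [s])
    (hv : v ∈ P.pos w (seg t 0 a)) (hx : x ∈ P.pos v [r]) : x ∈ P.pos w (seg t 0 n) :=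
  mem_pos_append a.zero_le (lt_of_mem_sig_seg hs).le hv
    (mem_pos_of_mem_sig (mem_sig_of_mem_sig_singleton hs hr) hx)

theorem Fused.exists_decidingBlock (hn : P.Nice) (hs : P.Smooth) (hf : P.Finitary) (hg : P.Growing)
    (hab : P.ABOne) {w : List A} {t : ℕ → WeakCreature A D} (h : P.Fused τ w t) {m : ℕ}
    (hm : 2 ≤ m) :
    ∃ n b s, P.DecidingBlock τ w t m b m n s ∧ minNor t m n / 2 ≤ s.nor := by
  obtain ⟨z, hz, hdec⟩ := h.exists_isDecisionFunction hn hg m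
  have hnor : ∀ i, m ≤ i → 2 < (t i).nor := fun i hi => by
    have hmdn := h.candidate.linked.strictMono.le_apply (x := i)
    exact lt_of_le_of_lt (by exact_mod_cast hm.trans (hi.trans hmdn)) (h.normed i)
  obtain ⟨n, -, s, hsig, hsn, hs'⟩ := hab w t h.candidate m hnor z hz
  obtain ⟨b, hb⟩ := hf.exists_decidesBelow h.candidate τ m n
  refine ⟨n, b, s, ⟨hsig, fun v hv r hr hr0 => ?_⟩, hsn⟩
  obtain ⟨t', hpc, hle, hhalf, x, hx, hzx⟩ := hs' v hv r hr hr0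
  have hkeep : ∀ i, P.KeepsHalf (fun i => t (m + i)) (t' i) := fun i c d hi => by
    obtain ⟨l, rfl⟩ := Nat.exists_eq_add_of_lt (lt_of_mem_sig_seg hi)
    rw [minNor_shift]
    rw [seg_shift] at hi
    simp only [← add_assoc] at hi ⊢
    exact hhalf i c l hi
  obtain ⟨k, hk, b', hkd⟩ := hdec v hv t' ⟨hpc, hle, hkeep⟩
  have hxn := mem_pos_seg_of_mem_sig_block hsig hr hv hx
  refine ⟨x, hx, hb x hxn ⟨b', h.candidate.tail hn hxn, h.normed.shift n, ?_⟩⟩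
  exact hs.decidesBelow_of_prefix h.candidate h.normed hk hkd
    (QStarSInf.le_condition_tail (p := h.candidate.condition h.normed) hn hxn) hzx

theorem exists_collapse {t : ℕ → WeakCreature A D} (ht : ∀ i, t i ∈ P.K) {m n : ℕ}
    {s : WeakCreature A D} (hs : s ∈ P.Sig (seg t m n)) :
    ∃ (k : ℕ → ℕ) (t' : ℕ → WeakCreature A D), StrictMono k ∧
      (∀ i, t' i ∈ P.Sig (seg t (k i) (k (i + 1)))) ∧ (∀ i ≤ m, k i = i) ∧ k (m + 1) = n ∧
      (∀ i < m, t' i = t i) ∧ t' m = s := by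
  have hmn := lt_of_mem_sig_seg hs
  let k : ℕ → ℕ := fun i => if i ≤ m then i else i - (m + 1) + n
  let t' : ℕ → WeakCreature A D := fun i => if i = m then s else t (k i)
  have hk : ∀ i, i ≠ m → k (i + 1) = k i + 1 := fun i hi => by grind
  have hkm : k m = m := if_pos le_rfl
  have hkm' : k (m + 1) = n := by grind
  refine ⟨k, t', strictMono_nat_of_lt_succ fun i => ?_, fun i => ?_, fun i hi => if_pos hi, hkm',
    fun i hi => ?_, if_pos rfl⟩
  · by_cases hi : i = m
    · rw [hi, hkm, hkm']
      exact hmn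
    · rw [hk i hi]
      exact Nat.lt_succ_self _
  · by_cases hi : i = m
    · simpa only [t', hi, if_true, hkm, hkm'] using hs
    · simpa only [t', if_neg hi, hk i hi, seg_succ] using P.sig_self _ (ht (k i))
  · simp only [t', k, if_neg hi.ne, if_pos hi.le]

theorem ABZero.exists_prolongation (hn : P.Nice) (hab : P.ABZero) {w : List A}
    {t : ℕ → WeakCreature A D} (hw : P.Candidate w t) {a m n : ℕ} (ham : a ≤ m)
    {s : WeakCreature A D} (hs : s ∈ P.Sig (seg t m n)) {c : ℝ≥0}
    (hct : ∀ i, a ≤ i → i < m → c < (t i).nor) (hcs : c < s.nor) :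
    ∃ T ∈ P.Sig (seg t a n), c < T.nor ∧ ∀ v ∈ P.pos w (seg t 0 a), ∀ r ∈ P.Sig [T], 0 < r.nor →
      ∃ s' ∈ P.Sig [s], 0 < s'.nor ∧ ∃ u ∈ P.pos v (seg t a m), P.pos u [s'] ⊆ P.pos v [r] := by
  obtain ⟨k, t', hk, ht', hkm, hkn, htm, rfl⟩ := exists_collapse (fun i => (hw i).1) hs
  have hseg : ∀ i ≤ m, ∀ j, seg t' j i = seg t j i := fun i hi j =>
    seg_congr fun l _ hl => htm l (hl.trans_le hi)
  have hw' : P.Candidate w t' := hw.refine hn hk ht' (by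
    rw [hkm 0 m.zero_le]
    exact mem_pos_seg_self 0)
  have ham' : a < m + 1 := Nat.lt_succ_of_le ham
  obtain ⟨T, hT, hTn, hT'⟩ := hab t' a (m + 1) (hw'.pfc ham') m ham m.lt_succ_self
  have hTsig : T ∈ P.Sig (seg t a n) := by
    simpa only [hkm a ham, hkn] using mem_sig_of_mem_sig_refinement hk ht' ham'.le hT
  refine ⟨T, hTsig, lt_of_lt_of_le ?_ hTn, fun v hv r hr hr0 => ?_⟩
  · obtain ⟨i, hai, him, hmin⟩ := exists_minNor_eq t' ham'
    rw [hmin]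
    obtain rfl | him := (Nat.le_of_lt_succ him).eq_or_lt
    · exact hcs
    · exact (htm i him).symm ▸ hct i hai him
  · obtain ⟨s', hs', hs0, u, hu, hus⟩ := hT' v (hw'.fc ham' ((hseg a ham 0).symm ▸ hv)) r hr hr0
    rw [hseg m le_rfl] at hu
    refine ⟨s', hs', hs0, u, hu, fun y hy => ?_⟩
    obtain ⟨x, hx, hyx⟩ := hus y hy
    have hyn := mem_pos_seg_of_mem_sig_block hs hs' (mem_pos_append a.zero_le ham hv hu) hy
    have hxn := mem_pos_seg_of_mem_sig_block hTsig hr hv hx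
    rwa [hyx.eq_of_length ((hw.length_of_mem_pos hyn).trans (hw.length_of_mem_pos hxn).symm)]

theorem DecidingBlock.exists_prolongation (hn : P.Nice) (hab : P.ABZero) {w : List A}
    {t : ℕ → WeakCreature A D} (hw : P.Candidate w t) {m b a l n : ℕ} {s : WeakCreature A D}
    (hs : P.DecidingBlock τ w t m b l n s) (hal : a ≤ l) {c : ℝ≥0}
    (hct : ∀ i, a ≤ i → i < l → c < (t i).nor) (hcs : c < s.nor) :
    ∃ T, P.DecidingBlock τ w t m b a n T ∧ c < T.nor := by
  obtain ⟨T, hT, hTn, hT'⟩ := hab.exists_prolongation hn hw hal hs.mem_sig hct hcs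
  refine ⟨T, ⟨hT, fun v hv r hr hr0 => ?_⟩, hTn⟩
  obtain ⟨s', hs', hs0, u, hu, hsub⟩ := hT' v hv r hr hr0
  obtain ⟨x, hx, hd⟩ :=
    hs.exists_decidesBelow u (mem_pos_append a.zero_le hal hv hu) s' hs' hs0
  exact ⟨x, hsub hx, hd⟩

theorem Condensed.exists_prefix_of_le (hn : P.Nice) (hc : P.Condensed) {q q' : P.QStarSInf}
    (hq : q ≤ q') (m : ℕ) :
    ∃ i ≥ m, ∃ s ∈ P.Sig [q.t i], 0 < s.nor ∧ ∃ v ∈ P.pos q.w (seg q.t 0 i),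
      ∀ u ∈ P.pos v [s], ∃ q'', q' ≤ q'' ∧ u <+: q''.w := by
  obtain ⟨k, hk, hkw, hkt⟩ := id hq
  obtain ⟨x, hx⟩ := q'.candidate.pos_nonempty m
  have hxq : x ∈ P.pos q.w (seg q.t 0 (k m)) :=
    mem_pos_append (Nat.zero_le _) (hk.monotone m.zero_le) hkw
      (mem_pos_of_mem_pos_refinement hk hkt m.zero_le hx)
  obtain ⟨i, hki, -, s, hs, v, hv, hs0, hu⟩ := hc x q.t _ _
    (q.candidate.fc (hk m.lt_succ_self) hxq) (fun i _ _ => pos_of_gt (q.normed i)) _ (hkt m)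
    (pos_of_gt (q'.normed m))
  refine ⟨i, hk.le_apply.trans hki, s, hs, hs0, v,
    mem_pos_append (Nat.zero_le _) hki hxq hv, fun u hu' => ?_⟩
  obtain ⟨y, hy, huy⟩ := hu u hu'
  exact ⟨_, QStarSInf.le_condition_tail hn (mem_pos_succ m.zero_le hx hy), huy⟩

theorem forcesInfOften_of_decidingBlock (hn : P.Nice) (hs : P.Smooth) (hc : P.Condensed)
    {w : List A} {t T : ℕ → WeakCreature A D} (hw : P.Candidate w t) (ht : Normed t) {k g : ℕ → ℕ}
    {B : Set ℕ} (hk : StrictMono k) (hk0 : k 0 = 0)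
    (hT : ∀ i, ∃ m ∈ B, k i ≤ m ∧ P.DecidingBlock τ w t m (g m) (k i) (k (i + 1)) (T i))
    {q : P.QStarSInf} (hqw : q.w = w) (hqT : q.t = T) : τ.ForcesInfOften q B g := by
  subst hqw hqT
  have hsig : ∀ i, q.t i ∈ P.Sig (seg t (k i) (k (i + 1))) := fun i => by
    obtain ⟨m, -, -, hb⟩ := hT i
    exact hb.mem_sig
  have hpq : hw.condition ht ≤ q := QStarSInf.le_of_pcle rfl ⟨k, hk, hk0, hsig⟩
  intro m₀ q' hqq'
  obtain ⟨i, hi, s, hs', hs0, v, hv, hu⟩ := hc.exists_prefix_of_le hn hqq' (m₀ + 1)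
  obtain ⟨m, hmB, hkm, hb⟩ := hT i
  have hvt := mem_pos_of_mem_pos_refinement hk hsig i.zero_le hv
  rw [hk0] at hvt
  obtain ⟨x, hx, hd⟩ := hb.exists_decidesBelow v hvt s hs' hs0
  obtain ⟨q'', hq'', hxq⟩ := hu x hx
  exact ⟨q'', hq'', m, hmB, Nat.lt_of_succ_le (hi.trans (hk.le_apply.trans hkm)),
    hs.decidesBelow_of_prefix hw ht (mem_pos_seg_of_mem_sig_block hb.mem_sig hs' hvt hx) hd
      (hpq.trans (hqq'.trans hq'')) hxq⟩

theorem Fused.exists_forcesInfOften (hn : P.Nice) (hs : P.Smooth) (hc : P.Condensed)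
    (hab : P.ABZero) {w : List A} {t : ℕ → WeakCreature A D} (h : P.Fused τ w t) {g : ℕ → ℕ}
    (hg : ∀ m, 2 ≤ m → ∃ n s, P.DecidingBlock τ w t m (g m) m n s ∧ minNor t m n / 2 ≤ s.nor)
    {B : Set ℕ} (hB : B.Infinite) :
    ∃ q, h.candidate.condition h.normed ≤ q ∧ τ.ForcesInfOften q B g := by
  have hlinked := h.candidate.linked
  have hblock : ∀ a, ∃ n, ∃ T ∈ P.Sig (seg t a n), (∃ m ∈ B, a ≤ m ∧
      P.DecidingBlock τ w t m (g m) a n T) ∧ ((t a).mdn : ℝ≥0) < T.nor := by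
    intro a
    obtain ⟨m, hmB, hm⟩ := hB.exists_gt (a + 2 * (t a).mdn + 2)
    have ham : a ≤ m := by lia
    obtain ⟨n, s, hb, hsn⟩ := hg m (by lia)
    have hsm : ((t a).mdn : ℝ≥0) < s.nor := by
      have hmdn := hlinked.strictMono.le_apply (x := m)
      refine lt_of_lt_of_le ?_ hsn
      rw [lt_div_iff₀ two_pos]
      refine lt_of_le_of_lt ?_ (h.normed.mdn_lt_minNor hlinked (lt_of_mem_sig_seg hb.mem_sig))
      exact_mod_cast (by lia : (t a).mdn * 2 ≤ (t m).mdn)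
    obtain ⟨T, hT, hTn⟩ := hb.exists_prolongation hn hab h.candidate ham
      (fun i hai _ => lt_of_le_of_lt (Nat.cast_le.2 (hlinked.strictMono.monotone hai)) (h.normed i))
      hsm
    exact ⟨n, T, hT.mem_sig, ⟨m, hmB, ham, hT⟩, hTn⟩
  obtain ⟨k, T, hk, hk0, hT⟩ := exists_refinement_of_forall_exists hblock
  have hle : P.PCLe t T := ⟨k, hk, hk0, fun i => (hT i).1⟩
  have hTn : Normed T := fun i => (mdn_of_mem_sig_seg (hT i).1).symm ▸ (hT i).2.2
  exact ⟨(h.candidate.pcle hn hle).condition hTn, QStarSInf.le_of_pcle rfl hle,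
    forcesInfOften_of_decidingBlock hn hs hc h.candidate h.normed hk hk0 (fun i => (hT i).2.1)
      rfl rfl⟩

theorem ABType.almostBounding (hn : P.Nice) (hs : P.Smooth) (hf : P.Finitary) (hg : P.Growing)
    (hc : P.Condensed) (hab : P.ABType) : AlmostBounding P.QStarSInf := by
  intro τ p
  obtain ⟨t, hpt, htn, htp⟩ := exists_fusion hn hf τ p.candidate.linked p.normed
  have h : P.Fused τ p.w t := ⟨p.candidate.pcle hn hpt, htn, htp⟩
  have hne : Nonempty (WeakCreature A D) := ⟨t 0⟩
  choose! n g s hblock using fun m (hm : 2 ≤ m) => h.exists_decidingBlock hn hs hf hg hab.2 hm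
  refine ⟨g, fun B hB => ?_⟩
  obtain ⟨q, hq, hforces⟩ :=
    h.exists_forcesInfOften hn hs hc hab.1 (fun m hm => ⟨n m, s m, hblock m hm⟩) hB
  have hle : p ≤ h.candidate.condition h.normed := QStarSInf.le_of_pcle rfl hpt
  exact ⟨q, hle.trans hq, hforces⟩

end CreatingPair

end Creatures

theorem mainTheorem12_general {A : Type*} {D : Type*} (H : Creatures.Alphabet A)
    (P : Creatures.CreatingPair H D) (hnice : P.Nice) (hsmooth : P.Smooth) :
    (P.Finitary → P.Growing → P.Condensed → P.ABType →
      Creatures.AlmostBounding P.QStarSInf) ∧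
    (∀ (e : ℕ → ℕ → D → D) (c : (Set ℕ → NNReal) → Finset ℕ → ℕ → List D → D)
      (half : Creatures.WeakCreature A D → Creatures.WeakCreature A D),
      P.StronglyFinitary → P.Omittory e → P.WeakHalving half → P.SaturatedNiceNat c →
      P.ValMonotone → P.SigExtend e →
      P.ABType ∧ (P.Condensed → Creatures.AlmostBounding P.QStarSInf)) := by
  refine ⟨fun hf hg hc hab => hab.almostBounding hnice hsmooth hf hg hc,
    fun e c half hf ho hh hsat hv he => ?_⟩
  have hab : P.ABType := ⟨ho.abZero hv he, hsat.abOne hnice hsmooth hf ho hh hv⟩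
  exact ⟨hab, fun hc => hab.almostBounding hnice hsmooth hf.1 ho.growing hc⟩

theorem mainTheorem12 {A : Type*} {D : Type*} (H : Creatures.Alphabet A)
    (P : Creatures.CreatingPair H D) (hnice : P.Nice) (hsmooth : P.Smooth) :
    (P.Finitary → P.Growing → P.Condensed → P.ABType →
      Creatures.AlmostBounding P.QStarSInf) ∧
    (∀ (e : ℕ → ℕ → D → D) (c : (Set ℕ → NNReal) → Finset ℕ → ℕ → List D → D)
      (half : Creatures.WeakCreature A D → Creatures.WeakCreature A D),
      P.StronglyFinitary → P.Omittory e → P.WeakHalving half → P.SaturatedNiceNat c →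
      P.ValMonotone → P.HalfExtend e half → P.SigExtend e →
      P.ABType ∧ (P.Condensed → Creatures.AlmostBounding P.QStarSInf)) := by
  exact (mainTheorem12_general H P hnice hsmooth).imp_right
    fun h e c half hf ho hh hsat hv _ he => h e c half hf ho hh hsat hv he
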